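/- Let $X\subset\mathbb{R}^2$ be an ellipse that is not a circle, parametrized by $S^1$ in the usual way ($e^{i\theta}\mapsto c+a\cos\theta\,e_1+b\sin\theta\,e_2$ with $(e_1,e_2)$ an orthonormal frame, $a,b>0$, $a\neq b$). An orthotripod on $X$ is an unordered triple $\{P_1,P_2,P_3\}$ of distinct points of $X$ such that the three normal lines to $X$ at $P_1,P_2,P_3$ have a common point. Via the parametrization, the set $T$ of orthotripods is regarded as a subspace of the symmetric cube $\mathrm{Sym}^3(S^1)=(S^1)^3/S_3$ with the quotient topology. Let $T^+\subset T$ be the subspace of the orthotripods that can be balanced by positive charges, i.e. for which there are $q_1,q_2,q_3>0$ such that at every $P_i$ the resultant Coulomb force $$F_i=\sum_{j\ne i}\frac{q_iq_j}{|P_i-P_j|^3}(P_i-P_j)$$ is orthogonal to the tangent line of $X$ at $P_i$. Then: 1. the closure $\overline{T}$ of $T$ in $\mathrm{Sym}^3(S^1)$ is homeomorphic to the closed cylinder $S^1\times[0,1]$ (with two boundary circles); 2. $T^+$ is homeomorphic to the open cylinder $S^1\times(0,1)$. -/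

import Mathlib

noncomputable section

/-- The Euclidean plane. -/
abbrev Plane : Type := EuclideanSpace ℝ (Fin 2)

/-- Two `n`-tuples are equivalent when they differ by a permutation of the indices. -/
def permSetoid (X : Type*) (n : ℕ) : Setoid (Fin n → X) where
  r x y := ∃ σ : Equiv.Perm (Fin n), y = x ∘ σ
  iseqv :=
    { refl := fun x => ⟨1, by funext i; rfl⟩
      symm := by
        rintro x y ⟨σ, rfl⟩
        exact ⟨σ⁻¹, by funext i; simp⟩
      trans := by
        rintro x y z ⟨σ, rfl⟩ ⟨τ, rfl⟩
        exact ⟨σ * τ, by funext i; simp⟩ }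

/-- The `n`-th symmetric power `X ^ n / S_n`: unordered `n`-tuples of points of `X`
(repetitions allowed).  For a topological space `X` it carries the quotient topology of the
product topology on `X ^ n`. -/
abbrev SymPower (X : Type*) (n : ℕ) : Type _ := Quotient (permSetoid X n)

/-- The unordered tuple underlying an ordered one. -/
def SymPower.mk {X : Type*} {n : ℕ} (x : Fin n → X) : SymPower X n :=
  Quotient.mk (permSetoid X n) x

section Curves

/- A closed plane curve is given by a parametrization `γ : Circle → Plane`. -/

/-- The tangent vector of the closed curve `γ` at the parameter `z`: the velocity at time `0` of
`s ↦ γ (z e^{is})`. -/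
def tangentVector (γ : Circle → Plane) (z : Circle) : Plane :=
  deriv (fun s : ℝ => γ (z * Circle.exp s)) 0

/-- The normal to the curve `γ` at `γ z`: the line through `γ z` orthogonal to the tangent. -/
def normalLine (γ : Circle → Plane) (z : Circle) : Set Plane :=
  {p | inner ℝ (p - γ z) (tangentVector γ z) = 0}

/-- The three points `γ (z i)` are distinct and the normals at them have a common point. -/
def IsOrthotripod (γ : Circle → Plane) (z : Fin 3 → Circle) : Prop :=
  Function.Injective (fun i => γ (z i)) ∧ ∃ p : Plane, ∀ i, p ∈ normalLine γ (z i)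

/-- The resultant at the `i`-th point of the Coulomb forces
`F_{ji} = q_i q_j (p_i - p_j) / d_{ij} ^ 3`, `j ≠ i`, of charges `q` placed at the points `p`. -/
def coulombForce {n : ℕ} (p : Fin n → Plane) (q : Fin n → ℝ) (i : Fin n) : Plane :=
  ∑ j ∈ Finset.univ.erase i, (q i * q j / dist (p i) (p j) ^ 3) • (p i - p j)

/-- The charges `q` are balancing for the points `γ (z i)`: they are not all zero, and at each of
the points the resultant force is orthogonal to the tangent of the curve. -/
def IsBalancedBy {n : ℕ} (γ : Circle → Plane) (z : Fin n → Circle) (q : Fin n → ℝ) : Prop :=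
  q ≠ 0 ∧ ∀ i, inner ℝ (coulombForce (fun j => γ (z j)) q i) (tangentVector γ (z i)) = 0

/-- The space of orthotripods, inside the symmetric cube of `S¹`. -/
def orthotripods (γ : Circle → Plane) : Set (SymPower Circle 3) :=
  {t | ∃ z : Fin 3 → Circle, SymPower.mk z = t ∧ IsOrthotripod γ z}

/-- The space of orthotripods that can be balanced by positive charges. -/
def positiveOrthotripods (γ : Circle → Plane) : Set (SymPower Circle 3) :=
  {t | ∃ z : Fin 3 → Circle, SymPower.mk z = t ∧ IsOrthotripod γ z ∧
    ∃ q : Fin 3 → ℝ, (∀ i, 0 < q i) ∧ IsBalancedBy γ z q}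

end Curves

/-- The ellipse with centre `c`, axes along the orthonormal frame `e`, and semi-axes `a`, `b`:
`e^{iθ} ↦ c + a cos θ • e₀ + b sin θ • e₁`. -/
def ellipseCurve (c : Plane) (e : OrthonormalBasis (Fin 2) ℝ Plane) (a b : ℝ) (z : Circle) :
    Plane :=
  c + (a * (z : ℂ).re) • e 0 + (b * (z : ℂ).im) • e 1

end

/-! Use the parameters u, v, w on the unit circle, with s = u + v + w and p = uvw. The normal
equation is a quartic in the parameter with no quadratic term and opposite extreme coefficients.
Three distinct roots on the circle therefore satisfy p(uv + vw + wu) = s, i.e. s = r p with r real,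
and conversely such triples have concurrent normals. Orthotripods are thus the `aligned` triples
with distinct entries, whatever the semi-axes.

An aligned triple is the root set of z^3 - r p z^2 + r z - p, so (p, r) determines it. A pair (p, r)
occurs iff `deltoidPoly` p r, minus the discriminant, is nonpositive (`exists_circle_triple`), and
equality means a repeated point. For fixed p, `deltoidHeight` turns this into an interval: it
increases in r and its absolute value is `deltoidPoly` + 27. So the aligned triples form S¹ × [-27,
27], and the orthotripods are its dense part where the height is not ±27.

For positive charges (`exists_pos_balance_iff`), balance means two things: the triangle uvw contains
the centre of the circle, i.e. r^2 < 1, and the common point of the normals is inside the ellipse.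
The latter is quadratic in r for fixed p, so over each p lies an open interval with continuous
endpoints. -/

open ComplexConjugate

/-! ### Self-inversive cubics and their roots on the circle -/

theorem discriminant_cubic_identity {U V W : ℂ} (hU : U ≠ 0) (hV : V ≠ 0) (hW : W ≠ 0)
    {r p : ℂ} (hp : p = U * V * W) (hs : U + V + W = r * p)
    (hs' : U⁻¹ + V⁻¹ + W⁻¹ = r * p⁻¹) :
    r ^ 4 - 4 * r ^ 3 * (p ^ 2 + (p⁻¹) ^ 2) + 18 * r ^ 2 - 27 =
      -((U - V) * (U⁻¹ - V⁻¹) * ((V - W) * (V⁻¹ - W⁻¹)) * ((W - U) * (W⁻¹ - U⁻¹))) := by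
  have hp0 : p ≠ 0 := by rw [hp]; exact mul_ne_zero (mul_ne_zero hU hV) hW
  have e1 : r ^ 2 = (U + V + W) * (U⁻¹ + V⁻¹ + W⁻¹) := by rw [hs, hs']; field_simp
  have e2 : r ^ 3 * p ^ 2 = (U + V + W) ^ 3 * p⁻¹ := by rw [hs]; field_simp
  have e3 : r ^ 3 * (p⁻¹) ^ 2 = (U⁻¹ + V⁻¹ + W⁻¹) ^ 3 * p := by rw [hs']; field_simp
  have : r ^ 4 - 4 * r ^ 3 * (p ^ 2 + (p⁻¹) ^ 2) + 18 * r ^ 2 - 27 =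
      (r ^ 2) ^ 2 - 4 * (r ^ 3 * p ^ 2 + r ^ 3 * (p⁻¹) ^ 2) + 18 * r ^ 2 - 27 := by ring
  rw [this, e1, e2, e3, hp]
  field_simp
  ring

theorem Circle.conj_coe (u : Circle) : conj (u : ℂ) = (u : ℂ)⁻¹ := by
  rw [← Circle.coe_inv_eq_conj, Circle.coe_inv]

/-- The real multiple of `uvw` equal to `u + v + w` satisfies the equation of a deltoid, up to
the discriminant. -/
theorem deltoid_eq_neg_discriminant {u v w p : Circle} {r : ℝ} (hp : p = u * v * w)
    (hs : (u + v + w : ℂ) = r * p) :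
    r ^ 4 - 8 * r ^ 3 * ((p : ℂ) ^ 2).re + 18 * r ^ 2 - 27 =
      -(Complex.normSq (u - v) * Complex.normSq (v - w) * Complex.normSq (w - u)) := by
  have hc : (u : ℂ)⁻¹ + (v : ℂ)⁻¹ + (w : ℂ)⁻¹ = r * (p : ℂ)⁻¹ := by
    have := congrArg conj hs
    simpa only [map_add, map_mul, Circle.conj_coe, Complex.conj_ofReal] using this
  have hp' : (p : ℂ) = u * v * w := by rw [hp]; simp
  have key := discriminant_cubic_identity u.coe_ne_zero v.coe_ne_zero w.coe_ne_zero hp' hs hc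
  apply Complex.ofReal_injective
  push_cast
  simp only [Complex.re_eq_add_conj, Complex.normSq_eq_conj_mul_self, map_pow, map_sub,
    Circle.conj_coe]
  linear_combination key

/-- Divided by 2i z^{3/2} p^{1/2}, the cubic becomes a real function of the angle of z. One full
turn changes its sign, so it vanishes somewhere. -/
theorem exists_circle_root (p : Circle) (r : ℝ) :
    ∃ u : Circle, (u : ℂ) ^ 3 - r * p * u ^ 2 + r * u - p = 0 := by
  obtain ⟨φ, rfl⟩ : ∃ φ : ℝ, Circle.exp φ = p := ⟨_, Circle.exp_arg p⟩
  set f : ℝ → ℝ := fun θ => Real.sin ((3 * θ - φ) / 2) - r * Real.sin ((θ + φ) / 2) with hf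
  have hcont : Continuous f := by fun_prop
  have hanti : f (2 * Real.pi) = -f 0 := by
    have h1 : (3 * (2 * Real.pi) - φ) / 2 = (3 * 0 - φ) / 2 + Real.pi + 2 * Real.pi := by ring
    have h2 : (2 * Real.pi + φ) / 2 = (0 + φ) / 2 + Real.pi := by ring
    simp only [hf, h1, h2, Real.sin_add_two_pi, Real.sin_add_pi]
    ring
  obtain ⟨θ, hθ⟩ : ∃ θ, f θ = 0 := by
    rcases le_total (f 0) 0 with h | h
    · exact mem_range_of_exists_le_of_exists_ge hcont ⟨0, h⟩ ⟨2 * Real.pi, by linarith⟩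
    · exact mem_range_of_exists_le_of_exists_ge hcont ⟨2 * Real.pi, by linarith⟩ ⟨0, h⟩
  refine ⟨Circle.exp θ, ?_⟩
  have hc : Complex.sin ((3 * θ - φ) / 2) - r * Complex.sin ((θ + φ) / 2) = 0 := by
    exact_mod_cast congrArg Complex.ofReal hθ
  set h := Complex.exp (θ / 2 * Complex.I) with hh
  set g := Complex.exp (φ / 2 * Complex.I) with hg
  have hh0 : h ≠ 0 := Complex.exp_ne_zero _
  have hg0 : g ≠ 0 := Complex.exp_ne_zero _
  have e1 : (Circle.exp θ : ℂ) = h ^ 2 := by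
    rw [Circle.coe_exp, hh, ← Complex.exp_nat_mul]; congr 1; push_cast; ring
  have e2 : (Circle.exp φ : ℂ) = g ^ 2 := by
    rw [Circle.coe_exp, hg, ← Complex.exp_nat_mul]; congr 1; push_cast; ring
  have e3 : Complex.sin ((3 * θ - φ) / 2) = (g / h ^ 3 - h ^ 3 / g) * Complex.I / 2 := by
    rw [Complex.sin, hh, hg, ← Complex.exp_nat_mul, ← Complex.exp_sub, ← Complex.exp_sub]
    congr 3 <;> congr 1 <;> push_cast <;> ring
  have e4 : Complex.sin ((θ + φ) / 2) = (1 / (h * g) - h * g) * Complex.I / 2 := by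
    rw [Complex.sin, hh, hg, ← Complex.exp_add, one_div, ← Complex.exp_neg]
    congr 3 <;> congr 1 <;> ring
  rw [e3, e4] at hc
  rw [e1, e2]
  have : ((g / h ^ 3 - h ^ 3 / g) - r * (1 / (h * g) - h * g)) * (Complex.I / 2) = 0 := by
    linear_combination hc
  have h2 := (mul_eq_zero.1 this).resolve_right (by simp)
  field_simp at h2
  linear_combination -h2

/-- Sum and product of two points of the circle. -/
theorem exists_circle_pair {σ : ℂ} {q : Circle} (hσ : σ = q * conj σ) (hn : ‖σ‖ ≤ 2) :
    ∃ v w : Circle, (v + w : ℂ) = σ ∧ v * w = q := by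
  obtain ⟨φ, rfl⟩ : ∃ φ : ℝ, Circle.exp φ = q := ⟨_, Circle.exp_arg q⟩
  -- A square root of q: the symmetry of σ says exactly that σ/η is real. The points are then η
  -- e^{±iα} with 2 cos α = σ/η.
  set η := Circle.exp (φ / 2) with hη
  have hηq : Circle.exp φ = η * η := by rw [hη, ← Circle.exp_add]; congr 1; ring
  have hη0 := η.coe_ne_zero
  have hreal : conj (σ * (η : ℂ)⁻¹) = σ * (η : ℂ)⁻¹ := by
    conv_rhs => rw [hσ, hηq]
    rw [map_mul, map_inv₀, Circle.conj_coe, Circle.coe_mul]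
    field_simp
  obtain ⟨t, ht⟩ := Complex.conj_eq_iff_real.1 hreal
  have hσt : σ = t * η := by rw [← ht]; field_simp
  have ht2 : |t| ≤ 2 := by
    rw [hσt, norm_mul, Circle.norm_coe, mul_one, Complex.norm_real] at hn
    exact hn
  have habs := abs_le.1 ht2
  have hcos : Real.cos (Real.arccos (t / 2)) = t / 2 :=
    Real.cos_arccos (by linarith) (by linarith)
  refine ⟨η * Circle.exp (Real.arccos (t / 2)), η * Circle.exp (-Real.arccos (t / 2)), ?_, ?_⟩
  · have h2 : (Circle.exp (Real.arccos (t / 2)) : ℂ) + Circle.exp (-Real.arccos (t / 2)) = t := by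
      have : (2 : ℂ) * Complex.cos (Real.arccos (t / 2)) = t := by
        rw [← Complex.ofReal_cos, hcos]; push_cast; ring
      rw [← this, Complex.two_cos, Circle.coe_exp, Circle.coe_exp]
      push_cast
      rfl
    rw [Circle.coe_mul, Circle.coe_mul, ← mul_add, h2, hσt, mul_comm]
  · rw [mul_mul_mul_comm, ← hηq, ← Circle.exp_add (Real.arccos _), add_neg_cancel,
      Circle.exp_zero, mul_one]

/-- Splitting off one root u on the circle leaves Q(z) = z^2 - σz + p/u, whose roots lie on the
circle once |σ| ≤ 2. The left side of `hD` equals (|σ|^2 - 4)|Q(u)|^2, so |σ| > 2 forces Q(u) = 0;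
then σ is the sum of the unit numbers u and p/u^2, a contradiction. -/
theorem exists_circle_triple (p : Circle) (r : ℝ)
    (hD : r ^ 4 - 8 * r ^ 3 * ((p : ℂ) ^ 2).re + 18 * r ^ 2 - 27 ≤ 0) :
    ∃ u v w : Circle, u * v * w = p ∧ (u + v + w : ℂ) = r * p := by
  obtain ⟨u, hu⟩ := exists_circle_root p r
  have hu0 := u.coe_ne_zero
  have hp0 := p.coe_ne_zero
  set σ : ℂ := r * p - u with hσ
  have hσc : conj σ = r * (p : ℂ)⁻¹ - (u : ℂ)⁻¹ := by simp [hσ, Circle.conj_coe]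
  have hrefl : σ = (p * u⁻¹ : Circle) * conj σ := by
    rw [hσc, hσ, Circle.coe_mul, Circle.coe_inv]
    field_simp
    linear_combination -hu
  have hn : ‖σ‖ ≤ 2 := by
    by_contra! hlt
    obtain ⟨δ, hδ⟩ := IsAlgClosed.exists_pow_nat_eq (σ ^ 2 - 4 * (p / u)) (n := 2) (by norm_num)
    obtain ⟨V, hV⟩ : ∃ V, V = (σ + δ) / 2 := ⟨_, rfl⟩
    obtain ⟨W, hW⟩ : ∃ W, W = (σ - δ) / 2 := ⟨_, rfl⟩
    have hVW : V * W = p / u := by rw [hV, hW]; linear_combination -hδ / 4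
    have hVW' : V + W = σ := by rw [hV, hW]; ring
    have hVW0 : V * W ≠ 0 := by rw [hVW]; exact div_ne_zero hp0 hu0
    have hV0 := left_ne_zero_of_mul hVW0
    have hW0 := right_ne_zero_of_mul hVW0
    have hinv : V⁻¹ + W⁻¹ = conj σ := by
      have : V + W = V * W * conj σ := by
        rw [hVW', hVW]; simpa [div_eq_mul_inv] using hrefl
      field_simp
      linear_combination this
    have key := discriminant_cubic_identity hu0 hV0 hW0 (r := r) (p := p)
      (by rw [mul_assoc, hVW]; field_simp) (by rw [add_assoc, hVW', hσ]; ring)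
      (by rw [add_assoc, hinv, hσc]; ring)
    have f1 : (V - W) * (V⁻¹ - W⁻¹) = 4 - σ * conj σ := by
      rw [← hinv, ← hVW']; field_simp; ring
    have f2 : (u - V) * (W - u) = -((u : ℂ) ^ 2 - σ * u + p / u) := by
      rw [← hVW', ← hVW]; ring
    have f3 : ((u : ℂ)⁻¹ - V⁻¹) * (W⁻¹ - (u : ℂ)⁻¹)
        = -conj ((u : ℂ) ^ 2 - σ * u + p / u) := by
      simp only [map_add, map_sub, map_mul, map_pow, map_div₀, Circle.conj_coe, ← hinv]
      have : ((p : ℂ)⁻¹ / (u : ℂ)⁻¹) = V⁻¹ * W⁻¹ := by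
        rw [← mul_inv, hVW]; field_simp
      rw [this]; ring
    have hid : r ^ 4 - 8 * r ^ 3 * ((p : ℂ) ^ 2).re + 18 * r ^ 2 - 27 =
        (Complex.normSq σ - 4) * Complex.normSq ((u : ℂ) ^ 2 - σ * u + p / u) := by
      apply Complex.ofReal_injective
      push_cast
      rw [Complex.re_eq_add_conj, Complex.normSq_eq_conj_mul_self,
        Complex.normSq_eq_conj_mul_self, map_pow, Circle.conj_coe]
      linear_combination key + (u - V) * (W - u) * (((u : ℂ)⁻¹ - V⁻¹) * (W⁻¹ - (u : ℂ)⁻¹)) * -f1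
        + (σ * conj σ - 4) * (f2 * (((u : ℂ)⁻¹ - V⁻¹) * (W⁻¹ - (u : ℂ)⁻¹))
        - ((u : ℂ) ^ 2 - σ * u + p / u) * f3)
    have hpos : 0 < Complex.normSq σ - 4 := by
      rw [Complex.normSq_eq_norm_sq]; nlinarith
    have hzero : Complex.normSq ((u : ℂ) ^ 2 - σ * u + p / u) = 0 := by
      rcases (Complex.normSq_nonneg ((u : ℂ) ^ 2 - σ * u + p / u)).eq_or_lt with h | h
      · exact h.symm
      · rw [hid] at hD; exact absurd hD (not_le.2 (mul_pos hpos h))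
    have hroot := Complex.normSq_eq_zero.1 hzero
    have hσ2 : σ = u + (p * (u * u)⁻¹ : Circle) := by
      have : σ * u = (u : ℂ) ^ 2 + p / u := by linear_combination -hroot
      rw [Circle.coe_mul, Circle.coe_inv, Circle.coe_mul, ← mul_left_inj' hu0, this]
      field_simp
    have : ‖σ‖ ≤ 2 := by
      rw [hσ2]
      refine (norm_add_le _ _).trans ?_
      rw [Circle.norm_coe, Circle.norm_coe]; norm_num
    linarith
  obtain ⟨v, w, h1, h2⟩ := exists_circle_pair hrefl hn
  refine ⟨u, v, w, ?_, ?_⟩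
  · rw [mul_assoc, h2, mul_comm u, mul_assoc, inv_mul_cancel, mul_one]
  · rw [add_assoc, h1, hσ]; ring

/-! ### Tangents and normals of the ellipse in the frame -/

section Ellipse

variable (c : Plane) (e : OrthonormalBasis (Fin 2) ℝ Plane) (a b : ℝ)

theorem tangentVector_ellipseCurve (z : Circle) :
    tangentVector (ellipseCurve c e a b) z
      = (-(a * (z : ℂ).im)) • e 0 + (b * (z : ℂ).re) • e 1 := by
  have hre : ∀ s : ℝ, ((z * Circle.exp s : Circle) : ℂ).re
      = (z : ℂ).re * Real.cos s - (z : ℂ).im * Real.sin s := fun s => by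
    rw [Circle.coe_mul, Circle.coe_exp, Complex.mul_re, Complex.exp_ofReal_mul_I_re,
      Complex.exp_ofReal_mul_I_im]
  have him : ∀ s : ℝ, ((z * Circle.exp s : Circle) : ℂ).im
      = (z : ℂ).re * Real.sin s + (z : ℂ).im * Real.cos s := fun s => by
    rw [Circle.coe_mul, Circle.coe_exp, Complex.mul_im, Complex.exp_ofReal_mul_I_re,
      Complex.exp_ofReal_mul_I_im]
  have h1 : HasDerivAt (fun s : ℝ => (z : ℂ).re * Real.cos s - (z : ℂ).im * Real.sin s)
      (-(z : ℂ).im) 0 := by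
    simpa using ((Real.hasDerivAt_cos 0).const_mul (z : ℂ).re).fun_sub
      ((Real.hasDerivAt_sin 0).const_mul (z : ℂ).im)
  have h2 : HasDerivAt (fun s : ℝ => (z : ℂ).re * Real.sin s + (z : ℂ).im * Real.cos s)
      (z : ℂ).re 0 := by
    simpa using ((Real.hasDerivAt_sin 0).const_mul (z : ℂ).re).fun_add
      ((Real.hasDerivAt_cos 0).const_mul (z : ℂ).im)
  have h := (((h1.const_mul a).smul_const (e 0)).const_add c).fun_add
    ((h2.const_mul b).smul_const (e 1))
  unfold tangentVector ellipseCurve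
  simp only [hre, him]
  rw [h.deriv, mul_neg]

theorem inner_frame (x y x' y' : ℝ) :
    inner ℝ (x • e 0 + y • e 1) (x' • e 0 + y' • e 1) = x * x' + y * y' := by
  have h0 : inner ℝ (e 0) (e 0) = (1 : ℝ) := by simp
  have h1 : inner ℝ (e 1) (e 1) = (1 : ℝ) := by simp
  have h01 : inner ℝ (e 0) (e 1) = (0 : ℝ) := by simp
  have h10 : inner ℝ (e 1) (e 0) = (0 : ℝ) := by simp
  simp only [inner_add_left, inner_add_right, real_inner_smul_left, real_inner_smul_right,
    h0, h1, h01, h10]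
  ring

theorem inner_ellipseCurve_sub_tangentVector (z w : Circle) :
    inner ℝ (ellipseCurve c e a b z - ellipseCurve c e a b w)
        (tangentVector (ellipseCurve c e a b) z)
      = b ^ 2 * (z : ℂ).re * ((z : ℂ).im - (w : ℂ).im)
        - a ^ 2 * (z : ℂ).im * ((z : ℂ).re - (w : ℂ).re) := by
  have : ellipseCurve c e a b z - ellipseCurve c e a b w
      = (a * ((z : ℂ).re - (w : ℂ).re)) • e 0 + (b * ((z : ℂ).im - (w : ℂ).im)) • e 1 := by
    unfold ellipseCurve; module
  rw [this, tangentVector_ellipseCurve, inner_frame]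
  ring

theorem add_frame_mem_normalLine_ellipseCurve (x y : ℝ) (z : Circle) :
    c + x • e 0 + y • e 1 ∈ normalLine (ellipseCurve c e a b) z ↔
      b * (z : ℂ).re * (y - b * (z : ℂ).im) - a * (z : ℂ).im * (x - a * (z : ℂ).re) = 0 := by
  have : c + x • e 0 + y • e 1 - ellipseCurve c e a b z
      = (x - a * (z : ℂ).re) • e 0 + (y - b * (z : ℂ).im) • e 1 := by
    unfold ellipseCurve; module
  rw [normalLine, Set.mem_ofPred_eq, this, tangentVector_ellipseCurve, inner_frame]
  constructor <;> intro h <;> linear_combination h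

theorem exists_eq_add_frame (p : Plane) : ∃ x y : ℝ, p = c + x • e 0 + y • e 1 := by
  refine ⟨e.repr (p - c) 0, e.repr (p - c) 1, ?_⟩
  have := e.sum_repr (p - c)
  rw [Fin.sum_univ_two] at this
  rw [add_assoc, this]
  simp

variable {a b}

theorem ellipseCurve_injective (ha : a ≠ 0) (hb : b ≠ 0) :
    Function.Injective (ellipseCurve c e a b) := by
  intro z w h
  have h0 : (a * ((z : ℂ).re - (w : ℂ).re)) • e 0 + (b * ((z : ℂ).im - (w : ℂ).im)) • e 1
      = 0 := by
    have := sub_eq_zero.2 h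
    rw [← this]; unfold ellipseCurve; module
  have h1 := inner_frame e (a * ((z : ℂ).re - (w : ℂ).re)) (b * ((z : ℂ).im - (w : ℂ).im)) 1 0
  have h2 := inner_frame e (a * ((z : ℂ).re - (w : ℂ).re)) (b * ((z : ℂ).im - (w : ℂ).im)) 0 1
  rw [h0, inner_zero_left] at h1 h2
  apply Circle.coe_injective
  apply Complex.ext
  · have : a * ((z : ℂ).re - (w : ℂ).re) = 0 := by linarith
    exact sub_eq_zero.1 ((mul_eq_zero.1 this).resolve_left ha)
  · have : b * ((z : ℂ).im - (w : ℂ).im) = 0 := by linarith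
    exact sub_eq_zero.1 ((mul_eq_zero.1 this).resolve_left hb)

end Ellipse

/-! ### Concurrent normals and alignment -/

theorem Circle.re_sq_add_im_sq (z : Circle) : (z : ℂ).re ^ 2 + (z : ℂ).im ^ 2 = 1 := by
  have := Circle.normSq_coe z
  rw [Complex.normSq_apply] at this
  linarith

/-- The common point of the normals at the points `u`, `v`, `w` of an ellipse with
`u + v + w = r (u v w)`, `p = u v w`. -/
theorem normal_equation_of_sum_eq {u v w p : Circle} {r : ℝ} (hp : p = u * v * w)
    (hs : (u + v + w : ℂ) = r * p) :
    r * ((p : ℂ).re * (u : ℂ).im + (p : ℂ).im * (u : ℂ).re)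
      + ((p : ℂ).im * (u : ℂ).re - (p : ℂ).re * (u : ℂ).im)
      = 2 * (u : ℂ).im * (u : ℂ).re := by
  have hc : (u : ℂ)⁻¹ + (v : ℂ)⁻¹ + (w : ℂ)⁻¹ = r * (p : ℂ)⁻¹ := by
    have := congrArg conj hs
    simpa only [map_add, map_mul, Circle.conj_coe, Complex.conj_ofReal] using this
  have hp' : (p : ℂ) = u * v * w := by rw [hp]; simp
  have hu := u.coe_ne_zero
  have hv := v.coe_ne_zero
  have hw := w.coe_ne_zero
  have hp0 := p.coe_ne_zero
  have e2 : (r : ℂ) = u * v + v * w + w * u := by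
    have : (r : ℂ) = ((u : ℂ)⁻¹ + (v : ℂ)⁻¹ + (w : ℂ)⁻¹) * p := by rw [hc]; field_simp
    rw [this, hp']; field_simp; ring
  have hcubic : (u : ℂ) ^ 3 - r * p * u ^ 2 + r * u - p = 0 := by
    rw [← hs, e2, hp']; ring
  apply Complex.ofReal_injective
  push_cast
  simp only [Complex.re_eq_add_conj, Complex.im_eq_sub_conj, Circle.conj_coe]
  have hI : (Complex.I) ≠ 0 := Complex.I_ne_zero
  field_simp
  -- The quartic of the normals is the cubic with roots u, v, w times a linear factor, whose root
  -- -1/p is the fourth foot.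
  linear_combination (-2 * (u * p + 1)) * hcubic

/-- Each equation is a quartic with no z^2 term and extreme coefficients k, -k. Three distinct roots
give p(uv + vw + wu) = s; on the circle uv + vw + wu = p · conj s, so s · conj p equals its
conjugate. -/
theorem sum_mul_conj_prod_im_eq_zero {u v w : Circle} (huv : u ≠ v) (hvw : v ≠ w) (hwu : w ≠ u)
    {A B k : ℝ} (hk : k ≠ 0)
    (hu : A * (u : ℂ).im + B * (u : ℂ).re + k * ((u : ℂ).im * (u : ℂ).re) = 0)
    (hv : A * (v : ℂ).im + B * (v : ℂ).re + k * ((v : ℂ).im * (v : ℂ).re) = 0)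
    (hw : A * (w : ℂ).im + B * (w : ℂ).re + k * ((w : ℂ).im * (w : ℂ).re) = 0) :
    ((u + v + w : ℂ) * conj (u * v * w : ℂ)).im = 0 := by
  have quartic : ∀ z : Circle, A * (z : ℂ).im + B * (z : ℂ).re
      + k * ((z : ℂ).im * (z : ℂ).re) = 0 →
      k * ((z : ℂ) ^ 4 - 1) + 2 * (A + B * Complex.I) * z ^ 3
        - 2 * (A - B * Complex.I) * z = 0 := by
    intro z hz
    have h : (A * (z : ℂ).im + B * (z : ℂ).re + k * ((z : ℂ).im * (z : ℂ).re) : ℂ) = 0 := by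
      exact_mod_cast hz
    have hz0 := z.coe_ne_zero
    have hI : (Complex.I) ≠ 0 := Complex.I_ne_zero
    simp only [Complex.re_eq_add_conj, Complex.im_eq_sub_conj, Circle.conj_coe] at h
    field_simp at h
    linear_combination h
  have qu := quartic u hu
  have qv := quartic v hv
  have qw := quartic w hw
  have n1 : (u - v : ℂ) ≠ 0 := sub_ne_zero.2 fun h => huv (Circle.coe_injective h)
  have n2 : (v - w : ℂ) ≠ 0 := sub_ne_zero.2 fun h => hvw (Circle.coe_injective h)
  have n3 : (w - u : ℂ) ≠ 0 := sub_ne_zero.2 fun h => hwu (Circle.coe_injective h)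
  have hk' : (k : ℂ) ≠ 0 := by exact_mod_cast hk
  -- The weights are cofactors that eliminate the z^3 and z terms. The remaining determinant
  -- contains the Vandermonde product.
  have hdet : (k * ((u - v) * (v - w) * (w - u)) : ℂ) *
      (u * v * w * (u * v + v * w + w * u) - (u + v + w)) = 0 := by
    linear_combination (-(v ^ 3 * w - w ^ 3 * v : ℂ)) * qu + (-(w ^ 3 * u - u ^ 3 * w : ℂ)) * qv
      + (-(u ^ 3 * v - v ^ 3 * u : ℂ)) * qw
  have hrel := (mul_eq_zero.1 hdet).resolve_left
    (mul_ne_zero hk' (mul_ne_zero (mul_ne_zero n1 n2) n3))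
  rw [← Complex.conj_eq_iff_im]
  have hu0 := u.coe_ne_zero
  have hv0 := v.coe_ne_zero
  have hw0 := w.coe_ne_zero
  simp only [map_mul, map_add, Circle.conj_coe, map_inv₀, inv_inv]
  field_simp
  linear_combination hrel

theorem eq_zero_and_eq_zero_of_sq_add_sq {x y : ℝ} (h : x ^ 2 + y ^ 2 = 0) : x = 0 ∧ y = 0 := by
  have := (add_eq_zero_iff_of_nonneg (sq_nonneg x) (sq_nonneg y)).1 h
  exact ⟨pow_eq_zero_iff two_ne_zero |>.1 this.1, pow_eq_zero_iff two_ne_zero |>.1 this.2⟩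

/-! ### Three unit vectors: cross products and the length of the sum -/

section UnitVectors

variable {c₁ s₁ c₂ s₂ c₃ s₃ : ℝ} (h₁ : c₁ ^ 2 + s₁ ^ 2 = 1) (h₂ : c₂ ^ 2 + s₂ ^ 2 = 1)
  (h₃ : c₃ ^ 2 + s₃ ^ 2 = 1)

include h₁ h₂ h₃

/-- For an inscribed triangle with angles A, B, C the cross products are, up to a common sign, sin
2A, sin 2B, sin 2C. The identity combines sin 2A + sin 2B + sin 2C = 4 sin A sin B sin C with |s|^2
= 1 - 8 cos A cos B cos C. -/
theorem four_mul_cross_mul_cross_mul_cross :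
    4 * ((c₁ * s₂ - s₁ * c₂) * (c₂ * s₃ - s₂ * c₃) * (c₃ * s₁ - s₃ * c₁))
      = (1 - ((c₁ + c₂ + c₃) ^ 2 + (s₁ + s₂ + s₃) ^ 2))
        * ((c₁ * s₂ - s₁ * c₂) + (c₂ * s₃ - s₂ * c₃) + (c₃ * s₁ - s₃ * c₁)) := by
  grind

/-- The sum is twice the signed area of the triangle. `key` is the square of the formula "product of
sides = 4 · area · circumradius", with circumradius one. -/
theorem sum_cross_ne_zero (h₁₂ : ¬(c₁ = c₂ ∧ s₁ = s₂)) (h₂₃ : ¬(c₂ = c₃ ∧ s₂ = s₃))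
    (h₃₁ : ¬(c₃ = c₁ ∧ s₃ = s₁)) :
    (c₁ * s₂ - s₁ * c₂) + (c₂ * s₃ - s₂ * c₃) + (c₃ * s₁ - s₃ * c₁) ≠ 0 := by
  have key : 4 * ((c₁ * s₂ - s₁ * c₂) + (c₂ * s₃ - s₂ * c₃) + (c₃ * s₁ - s₃ * c₁)) ^ 2
      = ((c₁ - c₂) ^ 2 + (s₁ - s₂) ^ 2) * ((c₂ - c₃) ^ 2 + (s₂ - s₃) ^ 2)
        * ((c₃ - c₁) ^ 2 + (s₃ - s₁) ^ 2) := by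
    have lag : ∀ {c s c' s' : ℝ}, c ^ 2 + s ^ 2 = 1 → c' ^ 2 + s' ^ 2 = 1 →
        (c * s' - s * c') ^ 2 = 1 - (c * c' + s * s') ^ 2 := by
      intro c s c' s' h h'
      linear_combination (c' ^ 2 + s' ^ 2) * h + h'
    have mul : ∀ {c s c' s' c'' s'' : ℝ}, c' ^ 2 + s' ^ 2 = 1 →
        (c * s' - s * c') * (c' * s'' - s' * c'')
          = (c * c' + s * s') * (c' * c'' + s' * s'') - (c'' * c + s'' * s) := by
      intro c s c' s' c'' s'' h
      linear_combination -(c'' * c + s'' * s) * h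
    have dist : ∀ {c s c' s' : ℝ}, c ^ 2 + s ^ 2 = 1 → c' ^ 2 + s' ^ 2 = 1 →
        (c - c') ^ 2 + (s - s') ^ 2 = 2 * (1 - (c * c' + s * s')) := by
      intro c s c' s' h h'
      linear_combination h + h'
    -- The Gram determinant of three vectors in the plane vanishes.
    have gram : (c₁ ^ 2 + s₁ ^ 2) * (c₂ ^ 2 + s₂ ^ 2) * (c₃ ^ 2 + s₃ ^ 2)
        + 2 * (c₁ * c₂ + s₁ * s₂) * (c₂ * c₃ + s₂ * s₃) * (c₃ * c₁ + s₃ * s₁)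
        - (c₁ ^ 2 + s₁ ^ 2) * (c₂ * c₃ + s₂ * s₃) ^ 2
        - (c₂ ^ 2 + s₂ ^ 2) * (c₃ * c₁ + s₃ * s₁) ^ 2
        - (c₃ ^ 2 + s₃ ^ 2) * (c₁ * c₂ + s₁ * s₂) ^ 2 = 0 := by ring
    rw [h₁, h₂, h₃] at gram
    rw [dist h₁ h₂, dist h₂ h₃, dist h₃ h₁]
    have l₁ := lag h₁ h₂
    have l₂ := lag h₂ h₃
    have l₃ := lag h₃ h₁
    have m₁ := mul (c := c₁) (s := s₁) (c'' := c₃) (s'' := s₃) h₂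
    have m₂ := mul (c := c₂) (s := s₂) (c'' := c₁) (s'' := s₁) h₃
    have m₃ := mul (c := c₃) (s := s₃) (c'' := c₂) (s'' := s₂) h₁
    generalize c₁ * s₂ - s₁ * c₂ = X at *
    generalize c₂ * s₃ - s₂ * c₃ = Y at *
    generalize c₃ * s₁ - s₃ * c₁ = Z at *
    linear_combination 4 * l₁ + 4 * l₂ + 4 * l₃ + 8 * m₁ + 8 * m₂ + 8 * m₃ + 4 * gram
  have pos : ∀ {p q p' q' : ℝ}, ¬(p = p' ∧ q = q') → (p - p') ^ 2 + (q - q') ^ 2 ≠ 0 := by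
    intro p q p' q' h h0
    have := eq_zero_and_eq_zero_of_sq_add_sq h0
    exact h ⟨sub_eq_zero.1 this.1, sub_eq_zero.1 this.2⟩
  intro h
  rw [h] at key
  exact mul_ne_zero (mul_ne_zero (pos h₁₂) (pos h₂₃)) (pos h₃₁) (by linarith)

/-- A sum of three unit vectors is long if one of them lies in the cone
spanned by the other two. -/
theorem one_le_norm_sum_of_cross (h : 0 < c₁ * s₂ - s₁ * c₂)
    (h' : (c₂ * s₃ - s₂ * c₃) + (c₃ * s₁ - s₃ * c₁) ≤ 0) :
    1 ≤ (c₁ + c₂ + c₃) ^ 2 + (s₁ + s₂ + s₃) ^ 2 := by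
  have e : ((c₁ + c₂) * c₃ + (s₁ + s₂) * s₃) * (c₁ * s₂ - s₁ * c₂)
      = -((c₂ * s₃ - s₂ * c₃) + (c₃ * s₁ - s₃ * c₁)) * (1 + (c₁ * c₂ + s₁ * s₂)) := by
    grind
  have hdot : 0 ≤ 1 + (c₁ * c₂ + s₁ * s₂) := by
    nlinarith [sq_nonneg (c₁ + c₂), sq_nonneg (s₁ + s₂)]
  have : 0 ≤ (c₁ + c₂) * c₃ + (s₁ + s₂) * s₃ := by
    by_contra! hneg
    have := mul_neg_of_neg_of_pos hneg h
    have := mul_nonneg (neg_nonneg.2 h') hdot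
    linarith
  nlinarith

theorem cross_pos_of_norm_sum_lt_one (hlt : (c₁ + c₂ + c₃) ^ 2 + (s₁ + s₂ + s₃) ^ 2 < 1)
    (h : 0 < c₁ * s₂ - s₁ * c₂) : 0 < c₂ * s₃ - s₂ * c₃ ∧ 0 < c₃ * s₁ - s₃ * c₁ := by
  have hsum : 0 < (c₂ * s₃ - s₂ * c₃) + (c₃ * s₁ - s₃ * c₁) := by
    by_contra! hneg
    exact absurd (one_le_norm_sum_of_cross h₁ h₂ h₃ h hneg) (not_le.2 hlt)
  have hprod : 0 < (c₁ * s₂ - s₁ * c₂) * ((c₂ * s₃ - s₂ * c₃) * (c₃ * s₁ - s₃ * c₁)) := by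
    have := mul_pos (sub_pos.2 hlt) (add_pos h hsum)
    have := four_mul_cross_mul_cross_mul_cross h₁ h₂ h₃
    nlinarith
  have hprod' := (mul_pos_iff_of_pos_left h).1 hprod
  rcases mul_pos_iff.1 hprod' with h | h
  · exact h
  · exact absurd hsum (by linarith [h.1, h.2])

/-- A short sum puts the origin inside the triangle; ε records the orientation. Reflecting in the
first axis reduces the negative case to the positive one. -/
theorem exists_sign_mul_cross_pos (h₁₂ : ¬(c₁ = c₂ ∧ s₁ = s₂)) (h₂₃ : ¬(c₂ = c₃ ∧ s₂ = s₃))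
    (h₃₁ : ¬(c₃ = c₁ ∧ s₃ = s₁)) (hlt : (c₁ + c₂ + c₃) ^ 2 + (s₁ + s₂ + s₃) ^ 2 < 1) :
    ∃ ε : ℝ, 0 < ε * (c₁ * s₂ - s₁ * c₂) ∧ 0 < ε * (c₂ * s₃ - s₂ * c₃) ∧
      0 < ε * (c₃ * s₁ - s₃ * c₁) := by
  have h0 := sum_cross_ne_zero h₁ h₂ h₃ h₁₂ h₂₃ h₃₁
  rcases lt_trichotomy (c₁ * s₂ - s₁ * c₂) 0 with h | h | h
  · have := cross_pos_of_norm_sum_lt_one (c₁ := c₁) (s₁ := -s₁) (c₂ := c₂) (s₂ := -s₂)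
      (c₃ := c₃) (s₃ := -s₃) (by simpa) (by simpa) (by simpa) (by linarith) (by linarith)
    exact ⟨-1, by linarith, by linarith, by linarith⟩
  · have := four_mul_cross_mul_cross_mul_cross h₁ h₂ h₃
    rw [h, zero_mul, zero_mul, mul_zero] at this
    rw [h] at h0
    exact absurd this.symm (mul_ne_zero (sub_pos.2 hlt).ne' h0)
  · have := cross_pos_of_norm_sum_lt_one h₁ h₂ h₃ hlt h
    exact ⟨1, by linarith, by linarith, by linarith⟩

theorem norm_sum_lt_one_of_sign {ε : ℝ} (h₁₂ : 0 < ε * (c₁ * s₂ - s₁ * c₂))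
    (h₂₃ : 0 < ε * (c₂ * s₃ - s₂ * c₃)) (h₃₁ : 0 < ε * (c₃ * s₁ - s₃ * c₁)) :
    (c₁ + c₂ + c₃) ^ 2 + (s₁ + s₂ + s₃) ^ 2 < 1 := by
  have key := four_mul_cross_mul_cross_mul_cross h₁ h₂ h₃
  have hp := mul_pos (mul_pos h₁₂ h₂₃) h₃₁
  have hs := add_pos (add_pos h₁₂ h₂₃) h₃₁
  have hε : ε ≠ 0 := by rintro rfl; simp at h₁₂
  have e : 4 * (ε * (c₁ * s₂ - s₁ * c₂) * (ε * (c₂ * s₃ - s₂ * c₃)) * (ε * (c₃ * s₁ - s₃ * c₁)))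
      = (1 - ((c₁ + c₂ + c₃) ^ 2 + (s₁ + s₂ + s₃) ^ 2)) * (ε ^ 2 * (ε * (c₁ * s₂ - s₁ * c₂)
        + ε * (c₂ * s₃ - s₂ * c₃) + ε * (c₃ * s₁ - s₃ * c₁))) := by
    linear_combination ε ^ 3 * key
  have hpos := mul_pos (sq_pos_of_ne_zero hε) hs
  have : 0 < 1 - ((c₁ + c₂ + c₃) ^ 2 + (s₁ + s₂ + s₃) ^ 2) := by
    refine (mul_pos_iff_of_pos_right hpos).1 ?_
    rw [← e]; linarith
  linarith

/-- A positive average of three distinct unit vectors is in the open unit disc. -/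
theorem norm_lt_one_of_weighted_sum_eq_zero (h₁₂ : ¬(c₁ = c₂ ∧ s₁ = s₂)) {g₁ g₂ g₃ X Y : ℝ}
    (hg₁ : 0 < g₁) (hg₂ : 0 < g₂) (hg₃ : 0 < g₃)
    (hX : g₁ * (X - c₁) + g₂ * (X - c₂) + g₃ * (X - c₃) = 0)
    (hY : g₁ * (Y - s₁) + g₂ * (Y - s₂) + g₃ * (Y - s₃) = 0) : X ^ 2 + Y ^ 2 < 1 := by
  have e : g₁ * ((X - c₁) ^ 2 + (Y - s₁) ^ 2) + g₂ * ((X - c₂) ^ 2 + (Y - s₂) ^ 2)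
      + g₃ * ((X - c₃) ^ 2 + (Y - s₃) ^ 2) = (g₁ + g₂ + g₃) * (1 - (X ^ 2 + Y ^ 2)) := by
    linear_combination 2 * X * hX + 2 * Y * hY + g₁ * h₁ + g₂ * h₂ + g₃ * h₃
  by_contra! hge
  have n₁ := mul_nonneg hg₁.le (add_nonneg (sq_nonneg (X - c₁)) (sq_nonneg (Y - s₁)))
  have n₂ := mul_nonneg hg₂.le (add_nonneg (sq_nonneg (X - c₂)) (sq_nonneg (Y - s₂)))
  have n₃ := mul_nonneg hg₃.le (add_nonneg (sq_nonneg (X - c₃)) (sq_nonneg (Y - s₃)))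
  have n₄ : (g₁ + g₂ + g₃) * (1 - (X ^ 2 + Y ^ 2)) ≤ 0 :=
    mul_nonpos_of_nonneg_of_nonpos (by linarith) (by linarith)
  have z₁ := (mul_eq_zero.1 (show g₁ * ((X - c₁) ^ 2 + (Y - s₁) ^ 2) = 0 by linarith)).resolve_left
    hg₁.ne'
  have z₂ := (mul_eq_zero.1 (show g₂ * ((X - c₂) ^ 2 + (Y - s₂) ^ 2) = 0 by linarith)).resolve_left
    hg₂.ne'
  obtain ⟨a₁, b₁⟩ := eq_zero_and_eq_zero_of_sq_add_sq z₁
  obtain ⟨a₂, b₂⟩ := eq_zero_and_eq_zero_of_sq_add_sq z₂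
  exact h₁₂ ⟨by linarith, by linarith⟩

end UnitVectors

/-! ### Positive solutions of the balance equations -/

/-- The position of `(x, y)` on the normal at a point of an ellipse: the multiplier of the
normal vector. -/
theorem normal_multiplier {a b c s x y : ℝ} (h : c ^ 2 + s ^ 2 = 1)
    (hN : b * c * (y - b * s) - a * s * (x - a * c) = 0) :
    (a * c * (x - a * c) + b * s * (y - b * s)) * c = a * (x - a * c) ∧
      (a * c * (x - a * c) + b * s * (y - b * s)) * s = b * (y - b * s) := by
  constructor
  · linear_combination s * hN + a * (x - a * c) * h
  · linear_combination -c * hN + b * (y - b * s) * h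

/-- A point inside the ellipse lies on the inner side of every tangent, so it is reached along the
inward normal. -/
theorem normal_multiplier_neg {a b c s x y : ℝ} (ha : 0 < a) (hb : 0 < b)
    (h : c ^ 2 + s ^ 2 = 1) (hN : b * c * (y - b * s) - a * s * (x - a * c) = 0)
    (hin : (x / a) ^ 2 + (y / b) ^ 2 < 1) :
    a * c * (x - a * c) + b * s * (y - b * s) < 0 := by
  obtain ⟨e₁, e₂⟩ := normal_multiplier h hN
  set μ := a * c * (x - a * c) + b * s * (y - b * s)
  have f : μ * ((c / a) ^ 2 + (s / b) ^ 2) = c * (x / a) + s * (y / b) - 1 := by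
    rw [← h]
    field_simp
    linear_combination c * b ^ 2 * e₁ + s * a ^ 2 * e₂
  have hlt : c * (x / a) + s * (y / b) - 1 < 0 := by
    nlinarith [sq_nonneg (c - x / a), sq_nonneg (s - y / b)]
  by_contra! hμ
  have := mul_nonneg hμ (add_nonneg (sq_nonneg (c / a)) (sq_nonneg (s / b)))
  linarith

/-- Positive solvability of the equations of balance at three points of an ellipse whose normals
meet at `(x, y)`. -/
theorem exists_pos_balance_iff {a b c₁ s₁ c₂ s₂ c₃ s₃ x y E₁ E₂ E₃ : ℝ} (ha : 0 < a) (hb : 0 < b)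
    (h₁ : c₁ ^ 2 + s₁ ^ 2 = 1) (h₂ : c₂ ^ 2 + s₂ ^ 2 = 1) (h₃ : c₃ ^ 2 + s₃ ^ 2 = 1)
    (h₁₂ : ¬(c₁ = c₂ ∧ s₁ = s₂)) (h₂₃ : ¬(c₂ = c₃ ∧ s₂ = s₃)) (h₃₁ : ¬(c₃ = c₁ ∧ s₃ = s₁))
    (hN₁ : b * c₁ * (y - b * s₁) - a * s₁ * (x - a * c₁) = 0)
    (hN₂ : b * c₂ * (y - b * s₂) - a * s₂ * (x - a * c₂) = 0)
    (hN₃ : b * c₃ * (y - b * s₃) - a * s₃ * (x - a * c₃) = 0)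
    (hE₁ : 0 < E₁) (hE₂ : 0 < E₂) (hE₃ : 0 < E₃) :
    (∃ q₁ q₂ q₃ : ℝ, (0 < q₁ ∧ 0 < q₂ ∧ 0 < q₃) ∧
      q₂ * E₃ * (b ^ 2 * c₁ * (s₁ - s₂) - a ^ 2 * s₁ * (c₁ - c₂))
        + q₃ * E₂ * (b ^ 2 * c₁ * (s₁ - s₃) - a ^ 2 * s₁ * (c₁ - c₃)) = 0 ∧
      q₁ * E₃ * (b ^ 2 * c₂ * (s₂ - s₁) - a ^ 2 * s₂ * (c₂ - c₁))
        + q₃ * E₁ * (b ^ 2 * c₂ * (s₂ - s₃) - a ^ 2 * s₂ * (c₂ - c₃)) = 0 ∧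
      q₁ * E₂ * (b ^ 2 * c₃ * (s₃ - s₁) - a ^ 2 * s₃ * (c₃ - c₁))
        + q₂ * E₁ * (b ^ 2 * c₃ * (s₃ - s₂) - a ^ 2 * s₃ * (c₃ - c₂)) = 0) ↔
    (c₁ + c₂ + c₃) ^ 2 + (s₁ + s₂ + s₃) ^ 2 < 1 ∧ (x / a) ^ 2 + (y / b) ^ 2 < 1 := by
  -- The decoupling: the tangential coefficient at one point due to another is the other point's
  -- multiplier times a cross product. The equations then say that q_i μ_i / E_i is proportional to
  -- (U, V, Z), barycentric weights of the origin.
  have f : ∀ {c s c' s' : ℝ}, c' ^ 2 + s' ^ 2 = 1 →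
      b * c * (y - b * s) - a * s * (x - a * c) = 0 →
      b * c' * (y - b * s') - a * s' * (x - a * c') = 0 →
      b ^ 2 * c * (s - s') - a ^ 2 * s * (c - c')
        = (a * c' * (x - a * c') + b * s' * (y - b * s')) * (c * s' - s * c') := by
    intro c s c' s' h hN hN'
    obtain ⟨e₁, e₂⟩ := normal_multiplier h hN'
    linear_combination -hN - c * e₂ + s * e₁
  rw [f h₂ hN₁ hN₂, f h₃ hN₁ hN₃, f h₁ hN₂ hN₁, f h₃ hN₂ hN₃, f h₁ hN₃ hN₁, f h₂ hN₃ hN₂]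
  obtain ⟨u₁, v₁⟩ := normal_multiplier h₁ hN₁
  obtain ⟨u₂, v₂⟩ := normal_multiplier h₂ hN₂
  obtain ⟨u₃, v₃⟩ := normal_multiplier h₃ hN₃
  have m₁ := normal_multiplier_neg ha hb h₁ hN₁
  have m₂ := normal_multiplier_neg ha hb h₂ hN₂
  have m₃ := normal_multiplier_neg ha hb h₃ hN₃
  clear f
  generalize a * c₁ * (x - a * c₁) + b * s₁ * (y - b * s₁) = μ₁ at *
  generalize a * c₂ * (x - a * c₂) + b * s₂ * (y - b * s₂) = μ₂ at *
  generalize a * c₃ * (x - a * c₃) + b * s₃ * (y - b * s₃) = μ₃ at *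
  have hX := sum_cross_ne_zero h₁ h₂ h₃ h₁₂ h₂₃ h₃₁
  have id_c : (c₂ * s₃ - s₂ * c₃) * c₁ + (c₃ * s₁ - s₃ * c₁) * c₂
      + (c₁ * s₂ - s₁ * c₂) * c₃ = 0 := by ring
  have id_s : (c₂ * s₃ - s₂ * c₃) * s₁ + (c₃ * s₁ - s₃ * c₁) * s₂
      + (c₁ * s₂ - s₁ * c₂) * s₃ = 0 := by ring
  have sgn := fun ε => norm_sum_lt_one_of_sign (ε := ε) h₁ h₂ h₃
  constructor
  · rintro ⟨q₁, q₂, q₃, ⟨hq₁, hq₂, hq₃⟩, w₁, w₂, w₃⟩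
    obtain ⟨Z, hZ⟩ : ∃ Z, Z = c₁ * s₂ - s₁ * c₂ := ⟨_, rfl⟩
    obtain ⟨U, hU⟩ : ∃ U, U = c₂ * s₃ - s₂ * c₃ := ⟨_, rfl⟩
    obtain ⟨V, hV⟩ : ∃ V, V = c₃ * s₁ - s₃ * c₁ := ⟨_, rfl⟩
    have r₁ : q₂ * μ₂ * (E₃ * Z) = q₃ * μ₃ * (E₂ * V) := by
      rw [hZ, hV]; linear_combination w₁
    have r₂ : q₁ * μ₁ * (E₃ * Z) = q₃ * μ₃ * (E₁ * U) := by
      rw [hZ, hU]; linear_combination -w₂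
    have r₃ : q₁ * μ₁ * (E₂ * V) = q₂ * μ₂ * (E₁ * U) := by
      rw [hV, hU]; linear_combination w₃
    rw [← hZ, ← hU, ← hV] at hX id_c id_s sgn
    -- Any linear relation with weights (U, V, Z) passes to the proportional weights; the case split
    -- finds a nonzero pivot. For the coordinates of the unit vectors it exhibits (x/a, y/b) as
    -- their average with positive weights q_i / E_i.
    have avg : ∀ {t₁ t₂ t₃ : ℝ}, U * t₁ + V * t₂ + Z * t₃ = 0 →
        q₁ / E₁ * (μ₁ * t₁) + q₂ / E₂ * (μ₂ * t₂) + q₃ / E₃ * (μ₃ * t₃) = 0 := by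
      intro t₁ t₂ t₃ ht
      by_cases hZ0 : Z = 0
      · by_cases hU0 : U = 0
        · have hV0 : V ≠ 0 := fun h => hX (by rw [hZ0, hU0, h]; ring)
          field_simp
          apply mul_left_cancel₀ hV0
          linear_combination q₂ * μ₂ * E₁ * E₃ * ht + t₁ * E₃ * r₃ - t₃ * E₁ * r₁
        · field_simp
          apply mul_left_cancel₀ hU0
          linear_combination q₁ * μ₁ * E₂ * E₃ * ht - t₂ * E₃ * r₃ - t₃ * E₂ * r₂
      · field_simp
        apply mul_left_cancel₀ hZ0
        linear_combination q₃ * μ₃ * E₁ * E₂ * ht + t₁ * E₂ * r₂ + t₂ * E₁ * r₁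
    have hc := avg id_c
    have hs := avg id_s
    rw [u₁, u₂, u₃] at hc
    rw [v₁, v₂, v₃] at hs
    have hin : (x / a) ^ 2 + (y / b) ^ 2 < 1 := by
      refine norm_lt_one_of_weighted_sum_eq_zero h₁ h₂ h₃ h₁₂ (div_pos hq₁ hE₁) (div_pos hq₂ hE₂)
        (div_pos hq₃ hE₃) ?_ ?_
      · have : a ^ 2 * (q₁ / E₁ * (x / a - c₁) + q₂ / E₂ * (x / a - c₂)
            + q₃ / E₃ * (x / a - c₃)) = 0 := by
          rw [← hc]; field_simp
        exact (mul_eq_zero.1 this).resolve_left (pow_ne_zero 2 ha.ne')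
      · have : b ^ 2 * (q₁ / E₁ * (y / b - s₁) + q₂ / E₂ * (y / b - s₂)
            + q₃ / E₃ * (y / b - s₃)) = 0 := by
          rw [← hs]; field_simp
        exact (mul_eq_zero.1 this).resolve_left (pow_ne_zero 2 hb.ne')
    refine ⟨?_, hin⟩
    -- With the common point inside, all multipliers are negative, so proportionality gives U, V, Z
    -- one sign; Z itself serves as the orientation factor.
    have m₁ := mul_neg_of_pos_of_neg hq₁ (m₁ hin)
    have m₂ := mul_neg_of_pos_of_neg hq₂ (m₂ hin)
    have m₃ := mul_neg_of_pos_of_neg hq₃ (m₃ hin)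
    generalize q₁ * μ₁ = y₁ at *
    generalize q₂ * μ₂ = y₂ at *
    generalize q₃ * μ₃ = y₃ at *
    have hZ0 : Z ≠ 0 := by
      intro h
      have hV0 : V = 0 := by
        rw [h, mul_zero, mul_zero] at r₁
        have := (mul_eq_zero.1 r₁.symm).resolve_left m₃.ne
        exact (mul_eq_zero.1 this).resolve_left hE₂.ne'
      have hU0 : U = 0 := by
        rw [h, mul_zero, mul_zero] at r₂
        have := (mul_eq_zero.1 r₂.symm).resolve_left m₃.ne
        exact (mul_eq_zero.1 this).resolve_left hE₁.ne'
      exact hX (by rw [h, hV0, hU0]; ring)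
    have hZZ : 0 < Z * Z := mul_self_pos.2 hZ0
    refine sgn Z hZZ ?_ ?_
    · have : y₃ * E₁ * (Z * U) = y₁ * E₃ * (Z * Z) := by linear_combination -Z * r₂
      have hl := mul_neg_of_neg_of_pos (mul_neg_of_neg_of_pos m₁ hE₃) hZZ
      rw [← this] at hl
      exact pos_of_mul_neg_right hl (mul_neg_of_neg_of_pos m₃ hE₁).le
    · have : y₃ * E₂ * (Z * V) = y₂ * E₃ * (Z * Z) := by linear_combination -Z * r₁
      have hl := mul_neg_of_neg_of_pos (mul_neg_of_neg_of_pos m₂ hE₃) hZZ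
      rw [← this] at hl
      exact pos_of_mul_neg_right hl (mul_neg_of_neg_of_pos m₃ hE₂).le
  · rintro ⟨hlt, hin⟩
    obtain ⟨ε, p₁₂, p₂₃, p₃₁⟩ := exists_sign_mul_cross_pos h₁ h₂ h₃ h₁₂ h₂₃ h₃₁ hlt
    have m₁ := m₁ hin
    have m₂ := m₂ hin
    have m₃ := m₃ hin
    have n₁ := m₁.ne
    have n₂ := m₂.ne
    have n₃ := m₃.ne
    refine ⟨E₁ * (ε * (c₂ * s₃ - s₂ * c₃)) / (-μ₁), E₂ * (ε * (c₃ * s₁ - s₃ * c₁)) / (-μ₂),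
      E₃ * (ε * (c₁ * s₂ - s₁ * c₂)) / (-μ₃),
      ⟨div_pos (mul_pos hE₁ p₂₃) (neg_pos.2 m₁), div_pos (mul_pos hE₂ p₃₁) (neg_pos.2 m₂),
        div_pos (mul_pos hE₃ p₁₂) (neg_pos.2 m₃)⟩, ?_, ?_, ?_⟩ <;> field_simp <;> ring

/-! ### Unordered triples with their product and ratio -/

open Classical in
theorem exists_perm_of_map_univ_eq {ι α : Type*} [Fintype ι] {f g : ι → α}
    (h : Finset.univ.val.map f = Finset.univ.val.map g) : ∃ σ : Equiv.Perm ι, f = g ∘ σ := by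
  have e : ∀ a, Nonempty ({i // f i = a} ≃ {i // g i = a}) := by
    intro a
    have := congrArg (Multiset.count a) h
    rw [Multiset.count_map, Multiset.count_map] at this
    refine Fintype.card_eq.1 ?_
    simp_rw [Fintype.card_subtype, eq_comm (b := a)]
    exact this
  exact ⟨Equiv.ofFiberEquiv fun a => (e a).some,
    funext fun i => (Equiv.ofFiberEquiv_map (fun a => (e a).some) i).symm⟩

/-- The product of an unordered triple of points of the circle. -/
noncomputable def SymPower.circleProd : SymPower Circle 3 → Circle :=
  Quotient.lift (fun z => ∏ i, z i) (by
    rintro z w ⟨σ, rfl⟩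
    exact (Equiv.prod_comp σ z).symm)

/-- The sum of an unordered triple of points of the circle. -/
noncomputable def SymPower.circleSum : SymPower Circle 3 → ℂ :=
  Quotient.lift (fun z => ∑ i, (z i : ℂ)) (by
    rintro z w ⟨σ, rfl⟩
    exact (Equiv.sum_comp σ fun i => (z i : ℂ)).symm)

namespace SymPower

theorem circleProd_mk (z : Fin 3 → Circle) : circleProd (mk z) = z 0 * z 1 * z 2 :=
  Fin.prod_univ_three z

theorem circleSum_mk (z : Fin 3 → Circle) : circleSum (mk z) = z 0 + z 1 + z 2 :=
  Fin.sum_univ_three fun i => (z i : ℂ)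

theorem exists_mk_eq (t : SymPower Circle 3) : ∃ z, mk z = t := Quotient.exists_rep t

theorem continuous_circleProd : Continuous circleProd :=
  Continuous.quotient_lift (by fun_prop) _

theorem continuous_circleSum : Continuous circleSum :=
  Continuous.quotient_lift (by fun_prop) _

instance : CompactSpace (SymPower Circle 3) := Quotient.compactSpace

open Polynomial in
/-- An unordered triple of points of the circle is determined by its sum and its product. -/
theorem ext_circle {t t' : SymPower Circle 3} (hs : circleSum t = circleSum t')
    (hp : circleProd t = circleProd t') : t = t' := by
  obtain ⟨z, rfl⟩ := exists_mk_eq t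
  obtain ⟨w, rfl⟩ := exists_mk_eq t'
  rw [circleSum_mk, circleSum_mk] at hs
  rw [circleProd_mk, circleProd_mk] at hp
  have hp' : (z 0 * z 1 * z 2 : ℂ) = w 0 * w 1 * w 2 := by exact_mod_cast congrArg Subtype.val hp
  -- On the circle the second symmetric function is determined by the other two, hence so is the
  -- monic cubic with these roots.
  have e₂ : ∀ x : Fin 3 → Circle, (x 0 * x 1 + x 1 * x 2 + x 2 * x 0 : ℂ)
      = x 0 * x 1 * x 2 * conj (x 0 + x 1 + x 2 : ℂ) := by
    intro x
    have h₀ := (x 0).coe_ne_zero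
    have h₁ := (x 1).coe_ne_zero
    have h₂ := (x 2).coe_ne_zero
    simp only [map_add, Circle.conj_coe]
    field_simp
    ring
  have hpoly : ∏ i, (X - C (z i : ℂ)) = ∏ i, (X - C (w i : ℂ)) := by
    have expand : ∀ x : Fin 3 → Circle, ∏ i, (X - C (x i : ℂ))
        = X ^ 3 - C (x 0 + x 1 + x 2 : ℂ) * X ^ 2
          + C (x 0 * x 1 + x 1 * x 2 + x 2 * x 0 : ℂ) * X - C (x 0 * x 1 * x 2 : ℂ) := by
      intro x
      rw [Fin.prod_univ_three]
      simp only [map_add, map_mul]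
      ring
    rw [expand, expand, e₂, e₂, hs, hp']
  have hroots := congrArg Polynomial.roots hpoly
  have hr : ∀ x : Fin 3 → Circle, (∏ i, (X - C (x i : ℂ))).roots
      = (Finset.univ.val.map x).map ((↑) : Circle → ℂ) := by
    intro x
    have h : ∏ i, (X - C (x i : ℂ)) = (((Finset.univ.val.map x).map ((↑) : Circle → ℂ)).map
        fun a => X - C a).prod := by
      exact (congrArg Multiset.prod ((Multiset.map_map _ _ _).trans (Multiset.map_map _ _ _))).symm
    rw [h, Polynomial.roots_multiset_prod_X_sub_C]
  rw [hr, hr] at hroots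
  have := Multiset.map_injective Circle.coe_injective hroots
  obtain ⟨σ, hσ⟩ := exists_perm_of_map_univ_eq this
  exact (Quotient.sound ⟨σ, hσ⟩ : mk w = mk z).symm

/-- The unordered triples `{u, v, w}` for which `u + v + w` is a real multiple of `uvw`. -/
def aligned : Set (SymPower Circle 3) :=
  {t | (circleSum t * conj (circleProd t : ℂ)).im = 0}

/-- The real number `r` with `u + v + w = r uvw`, for an aligned triple. -/
noncomputable def ratio (t : SymPower Circle 3) : ℝ := (circleSum t * conj (circleProd t : ℂ)).re

theorem circleSum_eq_ratio_mul {t : SymPower Circle 3} (ht : t ∈ aligned) :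
    circleSum t = ratio t * circleProd t := by
  have h : ((ratio t : ℝ) : ℂ) = circleSum t * conj (circleProd t : ℂ) :=
    Complex.ext rfl (by simpa using (show _ = (0 : ℝ) from ht).symm)
  rw [h, mul_assoc, Circle.conj_coe, inv_mul_cancel₀ (Circle.coe_ne_zero _), mul_one]

theorem aligned_of_circleSum_eq {t : SymPower Circle 3} {r : ℝ}
    (h : circleSum t = r * circleProd t) : t ∈ aligned ∧ ratio t = r := by
  have : circleSum t * conj (circleProd t : ℂ) = r := by
    rw [h, mul_assoc, Circle.conj_coe, mul_inv_cancel₀ (Circle.coe_ne_zero _), mul_one]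
  exact ⟨by rw [aligned, Set.mem_ofPred_eq, this, Complex.ofReal_im],
    by rw [ratio, this, Complex.ofReal_re]⟩

theorem continuous_ratio : Continuous ratio :=
  Complex.continuous_re.comp (continuous_circleSum.mul
    (Complex.continuous_conj.comp (continuous_subtype_val.comp continuous_circleProd)))

theorem isClosed_aligned : IsClosed aligned :=
  isClosed_eq (Complex.continuous_im.comp (continuous_circleSum.mul
    (Complex.continuous_conj.comp (continuous_subtype_val.comp continuous_circleProd))))
    continuous_const

/-- The quartic form defining a deltoid, restricted to the line of slope determined by `p`. -/
noncomputable def deltoidPoly (p : Circle) (r : ℝ) : ℝ :=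
  r ^ 4 - 8 * r ^ 3 * ((p : ℂ) ^ 2).re + 18 * r ^ 2 - 27

theorem deltoidPoly_mk {z : Fin 3 → Circle} (hz : mk z ∈ aligned) :
    deltoidPoly (circleProd (mk z)) (ratio (mk z)) =
      -(Complex.normSq (z 0 - z 1) * Complex.normSq (z 1 - z 2) * Complex.normSq (z 2 - z 0)) := by
  refine deltoid_eq_neg_discriminant (circleProd_mk z) ?_
  rw [← circleSum_mk, circleSum_eq_ratio_mul hz]

theorem deltoidPoly_nonpos {t : SymPower Circle 3} (ht : t ∈ aligned) :
    deltoidPoly (circleProd t) (ratio t) ≤ 0 := by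
  obtain ⟨z, rfl⟩ := exists_mk_eq t
  rw [deltoidPoly_mk ht, neg_nonpos]
  have := Complex.normSq_nonneg
  exact mul_nonneg (mul_nonneg (this _) (this _)) (this _)

theorem injective_iff_deltoidPoly_neg {z : Fin 3 → Circle} (hz : mk z ∈ aligned) :
    Function.Injective z ↔ deltoidPoly (circleProd (mk z)) (ratio (mk z)) < 0 := by
  rw [(deltoidPoly_nonpos hz).lt_iff_ne, deltoidPoly_mk hz, neg_ne_zero, mul_ne_zero_iff,
    mul_ne_zero_iff, Complex.normSq_eq_zero.ne, Complex.normSq_eq_zero.ne,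
    Complex.normSq_eq_zero.ne, sub_ne_zero, sub_ne_zero, sub_ne_zero]
  simp only [ne_eq, Circle.coe_inj]
  constructor
  · intro h
    exact ⟨⟨fun e => absurd (h e) (by decide), fun e => absurd (h e) (by decide)⟩,
      fun e => absurd (h e) (by decide)⟩
  · rintro ⟨⟨h₁, h₂⟩, h₃⟩ i j hij
    fin_cases i <;> fin_cases j <;> simp_all

theorem exists_aligned {p : Circle} {r : ℝ} (h : deltoidPoly p r ≤ 0) :
    ∃ t ∈ aligned, circleProd t = p ∧ ratio t = r := by
  obtain ⟨u, v, w, hp, hs⟩ := exists_circle_triple p r h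
  have hp' : circleProd (mk ![u, v, w]) = p := by rw [circleProd_mk]; exact hp
  have hs' : circleSum (mk ![u, v, w]) = r * circleProd (mk ![u, v, w]) := by
    rw [circleSum_mk, hp']; exact hs
  obtain ⟨h₁, h₂⟩ := aligned_of_circleSum_eq hs'
  exact ⟨_, h₁, hp', h₂⟩

theorem eq_of_aligned {t t' : SymPower Circle 3} (ht : t ∈ aligned) (ht' : t' ∈ aligned)
    (hp : circleProd t = circleProd t') (hr : ratio t = ratio t') : t = t' :=
  ext_circle (by rw [circleSum_eq_ratio_mul ht, circleSum_eq_ratio_mul ht', hp, hr]) hp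

end SymPower

/-! ### Straightening the deltoid region to a closed cylinder -/

/-- An increasing function of `r` whose absolute value is the deltoid polynomial up to a
constant. -/
noncomputable def deltoidHeight (c r : ℝ) : ℝ := r * |r| * (r ^ 2 - 8 * c * r + 18)

theorem deltoidHeight_neg_neg (c r : ℝ) : deltoidHeight (-c) (-r) = -deltoidHeight c r := by
  unfold deltoidHeight
  rw [abs_neg]
  ring

/-- The extreme case is c = 1, where r^4 - 8r^3 + 18r^2 has derivative 4r(r - 3)^2. A smaller c only
adds the nondecreasing term 8(1 - c)r^3. -/
theorem strictMonoOn_deltoidHeight_Ici {c : ℝ} (hc : c ≤ 1) :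
    StrictMonoOn (deltoidHeight c) (Set.Ici 0) := by
  intro x hx y hy hxy
  have hx : 0 ≤ x := hx
  have hy : 0 < y := hx.trans_lt hxy
  unfold deltoidHeight
  rw [abs_of_nonneg hx, abs_of_pos hy]
  have hS : 0 < x + y := by linarith
  have hP : 0 ≤ x * y := mul_nonneg hx hy.le
  have key : 0 < (x + y) * ((x + y) * (x ^ 2 + y ^ 2) - 8 * (x ^ 2 + x * y + y ^ 2)
      + 18 * (x + y)) := by
    have e : (x + y) * ((x + y) * (x ^ 2 + y ^ 2) - 8 * (x ^ 2 + x * y + y ^ 2) + 18 * (x + y))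
        = (y - x) ^ 2 * ((x + y - 4) ^ 2 + 2) + 2 * (x * y) * (x + y - 6) ^ 2 := by ring
    rw [e]
    have := sub_pos.2 hxy
    positivity
  have key' := (mul_pos_iff_of_pos_left hS).1 key
  have hcc : 0 ≤ 8 * (1 - c) * (x ^ 2 + x * y + y ^ 2) := by
    have := sub_nonneg.2 hc
    positivity
  have := mul_pos (sub_pos.2 hxy) (add_pos_of_pos_of_nonneg key' hcc)
  linarith

theorem strictMono_deltoidHeight {c : ℝ} (hc : |c| ≤ 1) : StrictMono (deltoidHeight c) := by
  obtain ⟨h₁, h₂⟩ := abs_le.1 hc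
  refine StrictMonoOn.Iic_union_Ici (a := 0) ?_ (strictMonoOn_deltoidHeight_Ici h₂)
  intro x hx y hy hxy
  have := strictMonoOn_deltoidHeight_Ici (c := -c) (by linarith)
    (show -y ∈ Set.Ici (0 : ℝ) from neg_nonneg.2 (show y ≤ 0 from hy))
    (show -x ∈ Set.Ici (0 : ℝ) from neg_nonneg.2 (show x ≤ 0 from hx)) (neg_lt_neg hxy)
  rw [deltoidHeight_neg_neg, deltoidHeight_neg_neg] at this
  linarith

theorem abs_deltoidHeight {c r : ℝ} (hc : |c| ≤ 1) :
    |deltoidHeight c r| = r ^ 4 - 8 * r ^ 3 * c + 18 * r ^ 2 := by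
  have h : 0 < r ^ 2 - 8 * c * r + 18 := by
    have := sq_le_one_iff_abs_le_one c |>.2 hc
    nlinarith [sq_nonneg (r - 4 * c)]
  unfold deltoidHeight
  rw [abs_mul, abs_mul, abs_abs, abs_of_pos h, ← pow_two, sq_abs]
  ring

theorem continuous_deltoidHeight : Continuous fun x : ℝ × ℝ => deltoidHeight x.1 x.2 := by
  unfold deltoidHeight
  fun_prop

theorem exists_deltoidHeight_eq {c y : ℝ} (hc : |c| ≤ 1) (hy : |y| ≤ 27) :
    ∃ r, deltoidHeight c r = y := by
  obtain ⟨h₁, h₂⟩ := abs_le.1 hc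
  obtain ⟨h₃, h₄⟩ := abs_le.1 hy
  -- At ±3, the extreme values of a sum of three unit numbers, the height is ±243 - 216c, which is
  -- beyond ±27 or equal to it.
  refine mem_range_of_exists_le_of_exists_ge
    (continuous_deltoidHeight.comp (Continuous.prodMk_right c)) ⟨-3, ?_⟩ ⟨3, ?_⟩
  · simp only [deltoidHeight, abs_neg, Nat.abs_ofNat]
    linarith
  · simp only [deltoidHeight, Nat.abs_ofNat]
    linarith

theorem Circle.abs_re_sq_le_one (p : Circle) : |((p : ℂ) ^ 2).re| ≤ 1 :=
  (Complex.abs_re_le_norm _).trans (by rw [norm_pow, Circle.norm_coe, one_pow])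

namespace SymPower

theorem deltoidPoly_eq (p : Circle) (r : ℝ) :
    deltoidPoly p r = |deltoidHeight ((p : ℂ) ^ 2).re r| - 27 := by
  rw [abs_deltoidHeight p.abs_re_sq_le_one, deltoidPoly]

/-- Coordinates on the space of aligned triples. -/
noncomputable def alignedMap (t : aligned) : Circle × Set.Icc (-27 : ℝ) 27 :=
  (circleProd t.1, ⟨deltoidHeight ((circleProd t.1 : ℂ) ^ 2).re (ratio t.1), abs_le.1 (by
    have := deltoidPoly_nonpos t.2
    rw [deltoidPoly_eq] at this
    linarith)⟩)

theorem continuous_alignedMap : Continuous alignedMap := by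
  have h₁ : Continuous fun t : aligned => circleProd t.1 :=
    continuous_circleProd.comp continuous_subtype_val
  have h₂ : Continuous fun t : aligned => ratio t.1 :=
    continuous_ratio.comp continuous_subtype_val
  refine h₁.prodMk (Continuous.subtype_mk ?_ _)
  exact continuous_deltoidHeight.comp
    ((Complex.continuous_re.comp ((continuous_subtype_val.comp h₁).pow 2)).prodMk h₂)

theorem bijective_alignedMap : Function.Bijective alignedMap := by
  constructor
  · intro t t' h
    have hp : circleProd t.1 = circleProd t'.1 := congrArg Prod.fst h
    have hr : deltoidHeight ((circleProd t.1 : ℂ) ^ 2).re (ratio t.1)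
        = deltoidHeight ((circleProd t'.1 : ℂ) ^ 2).re (ratio t'.1) :=
      congrArg (fun x => (x.2 : ℝ)) h
    rw [← hp] at hr
    exact Subtype.ext (eq_of_aligned t.2 t'.2 hp
      ((strictMono_deltoidHeight (Circle.abs_re_sq_le_one _)).injective hr))
  · rintro ⟨p, y, hy⟩
    obtain ⟨r, hr⟩ := exists_deltoidHeight_eq p.abs_re_sq_le_one (abs_le.2 hy)
    obtain ⟨t, ht, hp, ht'⟩ := exists_aligned (p := p) (r := r) (by
      rw [deltoidPoly_eq, hr]
      linarith [abs_le.2 hy])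
    refine ⟨⟨t, ht⟩, Prod.ext hp (Subtype.ext ?_)⟩
    simp only [alignedMap, hp, ht', hr]

instance : CompactSpace aligned := isCompact_iff_compactSpace.1 isClosed_aligned.isCompact

/-- The space of aligned triples is a closed cylinder. -/
noncomputable def alignedHomeomorph : aligned ≃ₜ Circle × Set.Icc (-27 : ℝ) 27 :=
  Continuous.homeoOfEquivCompactToT2 (f := Equiv.ofBijective _ bijective_alignedMap)
    continuous_alignedMap

/-- In the cylinder coordinates the set on the right is |height| < 27, and the open interval is
dense in the closed one. -/
theorem aligned_subset_closure :
    aligned ⊆ closure {t ∈ aligned | deltoidPoly (circleProd t) (ratio t) < 0} := by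
  intro t ht
  let g : Circle × Set.Icc (-27 : ℝ) 27 → SymPower Circle 3 := fun x => alignedHomeomorph.symm x
  have hg : Continuous g := continuous_subtype_val.comp alignedHomeomorph.symm.continuous
  let S : Set (Circle × Set.Icc (-27 : ℝ) 27) := {x | |(x.2 : ℝ)| < 27}
  have hS : alignedHomeomorph ⟨t, ht⟩ ∈ closure S := by
    have : Continuous fun s : ℝ => Set.projIcc (-27 : ℝ) 27 (by norm_num) s := continuous_projIcc
    set x := alignedHomeomorph ⟨t, ht⟩
    let φ : ℝ → Circle × Set.Icc (-27 : ℝ) 27 :=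
      fun s => (x.1, Set.projIcc (-27 : ℝ) 27 (by norm_num) s)
    have hφ : Continuous φ := continuous_const.prodMk this
    have hmem : (x.2 : ℝ) ∈ closure (Set.Ioo (-27 : ℝ) 27) := by
      rw [closure_Ioo (by norm_num)]; exact x.2.2
    have himg := image_closure_subset_closure_image hφ (Set.mem_image_of_mem φ hmem)
    have hφx : φ (x.2 : ℝ) = x := Prod.ext rfl (Set.projIcc_val (by norm_num) _)
    rw [hφx] at himg
    refine closure_mono ?_ himg
    rintro _ ⟨s, hs, rfl⟩
    show |((Set.projIcc (-27 : ℝ) 27 (by norm_num) s : Set.Icc (-27 : ℝ) 27) : ℝ)| < 27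
    rw [Set.projIcc_of_mem _ (Set.Ioo_subset_Icc_self hs)]
    exact abs_lt.2 hs
  have himg := image_closure_subset_closure_image hg (Set.mem_image_of_mem g hS)
  have hgt : g (alignedHomeomorph ⟨t, ht⟩) = t := by simp [g]
  rw [hgt] at himg
  refine closure_mono ?_ himg
  rintro _ ⟨x, hx, rfl⟩
  obtain ⟨t', rfl⟩ := alignedHomeomorph.surjective x
  have : g (alignedHomeomorph t') = t'.1 := by simp [g]
  rw [this]
  refine ⟨t'.2, ?_⟩
  rw [deltoidPoly_eq]
  have hx' : |deltoidHeight ((circleProd t'.1 : ℂ) ^ 2).re (ratio t'.1)| < 27 := hx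
  linarith

/-! ### Orthotripods of the ellipse as aligned triples -/

section Orthotripods

variable (c : Plane) (e : OrthonormalBasis (Fin 2) ℝ Plane) {a b : ℝ}

/-- For an aligned triple the normals of an ellipse meet in an explicit point. -/
theorem commonPoint_mem_normalLine (ha : a ≠ 0) (hb : b ≠ 0) {z : Fin 3 → Circle}
    (hz : mk z ∈ aligned) (i : Fin 3) :
    c + ((a ^ 2 - b ^ 2) * ((ratio (mk z) - 1) * (circleProd (mk z) : ℂ).re) / (2 * a)) • e 0
        + (-(a ^ 2 - b ^ 2) * ((ratio (mk z) + 1) * (circleProd (mk z) : ℂ).im) / (2 * b)) • e 1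
      ∈ normalLine (ellipseCurve c e a b) (z i) := by
  rw [add_frame_mem_normalLine_ellipseCurve]
  have hp := circleProd_mk z
  have hs := circleSum_eq_ratio_mul hz
  rw [circleSum_mk] at hs
  have key : ratio (mk z) * ((circleProd (mk z) : ℂ).re * (z i : ℂ).im
        + (circleProd (mk z) : ℂ).im * (z i : ℂ).re)
      + ((circleProd (mk z) : ℂ).im * (z i : ℂ).re - (circleProd (mk z) : ℂ).re * (z i : ℂ).im)
      = 2 * (z i : ℂ).im * (z i : ℂ).re := by
    match i with
    | 0 =>
      exact normal_equation_of_sum_eq hp hs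
    | 1 =>
      exact normal_equation_of_sum_eq (v := z 2) (w := z 0) (hp.trans (mul_rotate _ _ _))
        (by rw [← hs]; ring)
    | 2 =>
      exact normal_equation_of_sum_eq (v := z 0) (w := z 1)
        (hp.trans (mul_rotate _ _ _).symm) (by rw [← hs]; ring)
  field_simp
  linear_combination -(a ^ 2 - b ^ 2) * key

theorem isOrthotripod_ellipseCurve_iff (ha : 0 < a) (hb : 0 < b) (hab : a ≠ b)
    (z : Fin 3 → Circle) :
    IsOrthotripod (ellipseCurve c e a b) z ↔ Function.Injective z ∧ mk z ∈ aligned := by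
  have hinj := ellipseCurve_injective c e ha.ne' hb.ne'
  have h₁ : Function.Injective (fun i => ellipseCurve c e a b (z i)) ↔ Function.Injective z :=
    hinj.of_comp_iff z
  rw [IsOrthotripod, h₁]
  refine and_congr_right fun hz => ⟨?_, fun h => ⟨_, commonPoint_mem_normalLine c e ha.ne' hb.ne' h⟩⟩
  rintro ⟨p, hp⟩
  obtain ⟨x, y, rfl⟩ := exists_eq_add_frame c e p
  simp only [add_frame_mem_normalLine_ellipseCurve] at hp
  -- The leading coefficient of the quartic; it would vanish for a circle.
  have hk : a ^ 2 - b ^ 2 ≠ 0 := by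
    rw [sq_sub_sq]
    exact mul_ne_zero (by positivity) (sub_ne_zero.2 hab)
  have hq : ∀ i, -(a * x) * (z i : ℂ).im + b * y * (z i : ℂ).re
      + (a ^ 2 - b ^ 2) * ((z i : ℂ).im * (z i : ℂ).re) = 0 := fun i => by
    linear_combination hp i
  have := sum_mul_conj_prod_im_eq_zero (hz.ne (by decide : (0 : Fin 3) ≠ 1))
    (hz.ne (by decide : (1 : Fin 3) ≠ 2)) (hz.ne (by decide : (2 : Fin 3) ≠ 0)) hk
    (hq 0) (hq 1) (hq 2)
  rw [aligned, Set.mem_ofPred_eq, circleSum_mk, circleProd_mk, Circle.coe_mul, Circle.coe_mul]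
  exact this

theorem orthotripods_ellipseCurve (ha : 0 < a) (hb : 0 < b) (hab : a ≠ b) :
    orthotripods (ellipseCurve c e a b)
      = {t ∈ aligned | deltoidPoly (circleProd t) (ratio t) < 0} := by
  ext t
  constructor
  · rintro ⟨z, rfl, hz⟩
    obtain ⟨h₁, h₂⟩ := (isOrthotripod_ellipseCurve_iff c e ha hb hab z).1 hz
    exact ⟨h₂, (injective_iff_deltoidPoly_neg h₂).1 h₁⟩
  · rintro ⟨h₁, h₂⟩
    obtain ⟨z, rfl⟩ := exists_mk_eq t
    exact ⟨z, rfl, (isOrthotripod_ellipseCurve_iff c e ha hb hab z).2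
      ⟨(injective_iff_deltoidPoly_neg h₁).2 h₂, h₁⟩⟩

theorem closure_orthotripods_ellipseCurve (ha : 0 < a) (hb : 0 < b) (hab : a ≠ b) :
    closure (orthotripods (ellipseCurve c e a b)) = aligned := by
  rw [orthotripods_ellipseCurve c e ha hb hab]
  exact (closure_minimal (fun _ h => h.1) isClosed_aligned).antisymm aligned_subset_closure

end Orthotripods

end SymPower

/-! ### Open cylinders as regions between graphs -/

/-- The region between the graphs of two continuous functions is a cylinder. -/
theorem nonempty_homeomorph_region_between {X : Type*} [TopologicalSpace X] {L U : X → ℝ}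
    (hL : Continuous L) (hU : Continuous U) (hLU : ∀ x, L x < U x) :
    Nonempty ({x : X × ℝ | L x.1 < x.2 ∧ x.2 < U x.1} ≃ₜ X × Set.Ioo (0 : ℝ) 1) := by
  have hpos : ∀ x, 0 < U x - L x := fun x => sub_pos.2 (hLU x)
  refine ⟨{
    toFun := fun x => (x.1.1, ⟨(x.1.2 - L x.1.1) / (U x.1.1 - L x.1.1),
      div_pos (sub_pos.2 x.2.1) (hpos _),
      (div_lt_one (hpos _)).2 (sub_lt_sub_right x.2.2 _)⟩)
    invFun := fun y => ⟨(y.1, L y.1 + y.2 * (U y.1 - L y.1)), by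
      have h₀ := mul_pos y.2.2.1 (hpos y.1)
      have h₁ := mul_pos (sub_pos.2 y.2.2.2) (hpos y.1)
      constructor
      · show L y.1 < L y.1 + y.2 * (U y.1 - L y.1)
        linarith
      · show L y.1 + y.2 * (U y.1 - L y.1) < U y.1
        linarith⟩
    left_inv := fun x => Subtype.ext (Prod.ext rfl (by
      simp only [div_mul_cancel₀ _ (hpos x.1.1).ne', add_sub_cancel]))
    right_inv := fun y => Prod.ext rfl (Subtype.ext (by
      simp only [add_sub_cancel_left, mul_div_cancel_right₀ _ (hpos y.1).ne']))
    continuous_toFun := ?_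
    continuous_invFun := ?_ }⟩
  · refine (continuous_fst.comp continuous_subtype_val).prodMk (Continuous.subtype_mk ?_ _)
    exact Continuous.div (by fun_prop) (by fun_prop) fun x => (hpos _).ne'
  · refine Continuous.subtype_mk ?_ _
    fun_prop

/-- For fixed x the second condition is quadratic in r and cuts out an interval between two
continuous roots. By `h` it contains r = -1 for all x or r = 1 for all x, so it overlaps (-1, 1). -/
theorem nonempty_homeomorph_conic_region {X : Type*} [TopologicalSpace X] {A B : X → ℝ}
    (hA : Continuous A) (hB : Continuous B) (hA₀ : ∀ x, 0 ≤ A x) (hB₀ : ∀ x, 0 ≤ B x)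
    (hAB : ∀ x, 0 < A x + B x) (h : (∀ x, 4 * A x < 1) ∨ ∀ x, 4 * B x < 1) :
    Nonempty ({x : X × ℝ | x.2 ^ 2 < 1 ∧
      A x.1 * (x.2 - 1) ^ 2 + B x.1 * (x.2 + 1) ^ 2 < 1} ≃ₜ X × Set.Ioo (0 : ℝ) 1) := by
  have hΔ : ∀ x, 0 < A x + B x - 4 * (A x * B x) := by
    intro x
    have h₀ := hAB x
    have ha := hA₀ x
    have hb := hB₀ x
    rcases h with h | h
    · nlinarith [h x, mul_nonneg hb (sub_nonneg.2 (h x).le)]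
    · nlinarith [h x, mul_nonneg ha (sub_nonneg.2 (h x).le)]
  have hiff : ∀ x r, A x * (r - 1) ^ 2 + B x * (r + 1) ^ 2 < 1 ↔
      (A x - B x - √(A x + B x - 4 * (A x * B x))) / (A x + B x) < r ∧
        r < (A x - B x + √(A x + B x - 4 * (A x * B x))) / (A x + B x) := by
    intro x r
    have h₁ : A x * (r - 1) ^ 2 + B x * (r + 1) ^ 2 < 1 ↔
        (r * (A x + B x) - (A x - B x)) ^ 2 < A x + B x - 4 * (A x * B x) := by
      have e : A x + B x - 4 * (A x * B x) - (r * (A x + B x) - (A x - B x)) ^ 2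
          = (A x + B x) * (1 - (A x * (r - 1) ^ 2 + B x * (r + 1) ^ 2)) := by ring
      rw [← sub_pos, ← mul_pos_iff_of_pos_left (hAB x), ← e, sub_pos]
    rw [h₁, Real.sq_lt, div_lt_iff₀ (hAB x), lt_div_iff₀ (hAB x)]
    constructor <;> rintro ⟨h₂, h₃⟩ <;> constructor <;> linarith
  set ρ₁ := fun x => (A x - B x - √(A x + B x - 4 * (A x * B x))) / (A x + B x) with hρ₁
  set ρ₂ := fun x => (A x - B x + √(A x + B x - 4 * (A x * B x))) / (A x + B x) with hρ₂
  have c₁ : Continuous ρ₁ := Continuous.div (by fun_prop) (by fun_prop) fun x => (hAB x).ne'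
  have c₂ : Continuous ρ₂ := Continuous.div (by fun_prop) (by fun_prop) fun x => (hAB x).ne'
  have hroots : ∀ x, ρ₁ x < ρ₂ x ∧ ρ₁ x < 1 ∧ -1 < ρ₂ x := by
    intro x
    rcases h with h | h
    · obtain ⟨h₁, h₂⟩ := (hiff x (-1)).1 (by linarith [h x])
      exact ⟨h₁.trans h₂, h₁.trans (by norm_num), h₂⟩
    · obtain ⟨h₁, h₂⟩ := (hiff x 1).1 (by linarith [h x])
      exact ⟨h₁.trans h₂, h₁, lt_trans (by norm_num) h₂⟩
  obtain ⟨φ⟩ := nonempty_homeomorph_region_between (L := fun x => max (-1) (ρ₁ x))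
    (U := fun x => min 1 (ρ₂ x)) (continuous_const.max c₁) (continuous_const.min c₂) fun x => by
      obtain ⟨h₁, h₂, h₃⟩ := hroots x
      exact max_lt (lt_min (by norm_num) h₃) (lt_min h₂ h₁)
  refine ⟨(Homeomorph.setCongr ?_).trans φ⟩
  ext ⟨x, r⟩
  simp only [Set.mem_ofPred_eq, hiff, max_lt_iff, lt_min_iff, sq_lt_one_iff_abs_lt_one, abs_lt]
  tauto

/-! ### Positively balanced orthotripods form an open cylinder -/

theorem inner_coulombForce_three (p : Fin 3 → Plane) (q : Fin 3 → ℝ) (t : Plane) :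
    inner ℝ (coulombForce p q 0) t = q 0 * (q 1 * (dist (p 0) (p 1) ^ 3)⁻¹ * inner ℝ (p 0 - p 1) t
        + q 2 * (dist (p 2) (p 0) ^ 3)⁻¹ * inner ℝ (p 0 - p 2) t) ∧
    inner ℝ (coulombForce p q 1) t = q 1 * (q 0 * (dist (p 0) (p 1) ^ 3)⁻¹ * inner ℝ (p 1 - p 0) t
        + q 2 * (dist (p 1) (p 2) ^ 3)⁻¹ * inner ℝ (p 1 - p 2) t) ∧
    inner ℝ (coulombForce p q 2) t = q 2 * (q 0 * (dist (p 2) (p 0) ^ 3)⁻¹ * inner ℝ (p 2 - p 0) t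
        + q 1 * (dist (p 1) (p 2) ^ 3)⁻¹ * inner ℝ (p 2 - p 1) t) := by
  have e₀ : (Finset.univ : Finset (Fin 3)).erase 0 = {1, 2} := by decide
  have e₁ : (Finset.univ : Finset (Fin 3)).erase 1 = {0, 2} := by decide
  have e₂ : (Finset.univ : Finset (Fin 3)).erase 2 = {0, 1} := by decide
  refine ⟨?_, ?_, ?_⟩
  · rw [coulombForce, e₀, Finset.sum_pair (by decide), inner_add_left, real_inner_smul_left,
      real_inner_smul_left, dist_comm (p 2)]
    ring
  · rw [coulombForce, e₁, Finset.sum_pair (by decide), inner_add_left, real_inner_smul_left,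
      real_inner_smul_left, dist_comm (p 0)]
    ring
  · rw [coulombForce, e₂, Finset.sum_pair (by decide), inner_add_left, real_inner_smul_left,
      real_inner_smul_left, dist_comm (p 1)]
    ring

namespace SymPower

variable (c : Plane) (e : OrthonormalBasis (Fin 2) ℝ Plane) {a b : ℝ}

theorem normSq_circleSum {t : SymPower Circle 3} (ht : t ∈ aligned) :
    Complex.normSq (circleSum t) = ratio t ^ 2 := by
  rw [circleSum_eq_ratio_mul ht, map_mul, Circle.normSq_coe, Complex.normSq_ofReal, mul_one, sq]

/-- Cancelling the charge q_i from the force at the i-th point leaves the system of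
`exists_pos_balance_iff`, with E_i the inverse cube of the opposite side and the common point from
`commonPoint_mem_normalLine`. -/
theorem exists_pos_isBalancedBy_iff (ha : 0 < a) (hb : 0 < b) {z : Fin 3 → Circle}
    (hinj : Function.Injective z) (hz : mk z ∈ aligned) :
    (∃ q : Fin 3 → ℝ, (∀ i, 0 < q i) ∧ IsBalancedBy (ellipseCurve c e a b) z q) ↔
      ratio (mk z) ^ 2 < 1 ∧
        ((a ^ 2 - b ^ 2) * (circleProd (mk z) : ℂ).re / (2 * a ^ 2)) ^ 2 * (ratio (mk z) - 1) ^ 2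
        + ((a ^ 2 - b ^ 2) * (circleProd (mk z) : ℂ).im / (2 * b ^ 2)) ^ 2 * (ratio (mk z) + 1) ^ 2
          < 1 := by
  have hγ := ellipseCurve_injective c e ha.ne' hb.ne'
  have hN := fun i => (add_frame_mem_normalLine_ellipseCurve c e a b _ _ (z i)).1
    (commonPoint_mem_normalLine c e ha.ne' hb.ne' hz i)
  have hd : ∀ i j : Fin 3, i ≠ j →
      0 < (dist (ellipseCurve c e a b (z i)) (ellipseCurve c e a b (z j)) ^ 3)⁻¹ :=
    fun i j hij => inv_pos.2 (pow_pos (dist_pos.2 (hγ.ne (hinj.ne hij))) 3)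
  have hne : ∀ i j : Fin 3, i ≠ j →
      ¬((z i : ℂ).re = (z j : ℂ).re ∧ (z i : ℂ).im = (z j : ℂ).im) := fun i j hij h =>
    hinj.ne hij (Circle.coe_injective (Complex.ext h.1 h.2))
  have key := exists_pos_balance_iff ha hb (z 0).re_sq_add_im_sq (z 1).re_sq_add_im_sq
    (z 2).re_sq_add_im_sq (hne 0 1 (by decide)) (hne 1 2 (by decide)) (hne 2 0 (by decide))
    (hN 0) (hN 1) (hN 2) (hd 1 2 (by decide)) (hd 2 0 (by decide)) (hd 0 1 (by decide))
  have hsum : ((z 0 : ℂ).re + (z 1 : ℂ).re + (z 2 : ℂ).re) ^ 2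
      + ((z 0 : ℂ).im + (z 1 : ℂ).im + (z 2 : ℂ).im) ^ 2 = ratio (mk z) ^ 2 := by
    rw [← normSq_circleSum hz, circleSum_mk, Complex.normSq_apply]
    simp only [Complex.add_re, Complex.add_im]
    ring
  have hconic : ((a ^ 2 - b ^ 2) * ((ratio (mk z) - 1) * (circleProd (mk z) : ℂ).re) / (2 * a)
        / a) ^ 2 + (-(a ^ 2 - b ^ 2) * ((ratio (mk z) + 1) * (circleProd (mk z) : ℂ).im) / (2 * b)
        / b) ^ 2
      = ((a ^ 2 - b ^ 2) * (circleProd (mk z) : ℂ).re / (2 * a ^ 2)) ^ 2 * (ratio (mk z) - 1) ^ 2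
        + ((a ^ 2 - b ^ 2) * (circleProd (mk z) : ℂ).im / (2 * b ^ 2)) ^ 2
          * (ratio (mk z) + 1) ^ 2 := by
    ring
  rw [hsum, hconic] at key
  rw [← key]
  clear key hsum hconic hN
  have hforce := inner_coulombForce_three (fun j => ellipseCurve c e a b (z j))
  simp only [← inner_ellipseCurve_sub_tangentVector c e a b]
  constructor
  · rintro ⟨q, hq, -, hbal⟩
    refine ⟨q 0, q 1, q 2, ⟨hq 0, hq 1, hq 2⟩, ?_, ?_, ?_⟩
    · have := hbal 0
      rw [(hforce q _).1] at this
      exact (mul_eq_zero.1 this).resolve_left (hq 0).ne'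
    · have := hbal 1
      rw [(hforce q _).2.1] at this
      exact (mul_eq_zero.1 this).resolve_left (hq 1).ne'
    · have := hbal 2
      rw [(hforce q _).2.2] at this
      exact (mul_eq_zero.1 this).resolve_left (hq 2).ne'
  · rintro ⟨q₀, q₁, q₂, ⟨h₀, h₁, h₂⟩, w₀, w₁, w₂⟩
    refine ⟨![q₀, q₁, q₂], ?_, fun h => h₀.ne' (congrFun h 0), ?_⟩
    · intro i
      match i with
      | 0 => exact h₀
      | 1 => exact h₁
      | 2 => exact h₂
    · intro i
      match i with
      | 0 =>
        rw [(hforce _ _).1]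
        exact mul_eq_zero_of_right _ w₀
      | 1 =>
        rw [(hforce _ _).2.1]
        exact mul_eq_zero_of_right _ w₁
      | 2 =>
        rw [(hforce _ _).2.2]
        exact mul_eq_zero_of_right _ w₂

/-- The bound is 1 + 8 + 18 - 27 = 0. Hence r^2 < 1 already makes the three points distinct. -/
theorem deltoidPoly_neg_of_sq_lt_one (p : Circle) {r : ℝ} (hr : r ^ 2 < 1) :
    deltoidPoly p r < 0 := by
  have hc := abs_le.1 p.abs_re_sq_le_one
  have hr' := abs_lt.1 ((sq_lt_one_iff_abs_lt_one r).1 hr)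
  have h : |r ^ 3 * ((p : ℂ) ^ 2).re| ≤ 1 := by
    rw [abs_mul, abs_pow]
    exact mul_le_one₀ (pow_le_one₀ (abs_nonneg r) (abs_le.2 ⟨hr'.1.le, hr'.2.le⟩)) (abs_nonneg _)
      p.abs_re_sq_le_one
  have h' := abs_le.1 h
  have h₄ : r ^ 4 < 1 := by nlinarith [sq_nonneg r]
  unfold deltoidPoly
  linarith

theorem positiveOrthotripods_ellipseCurve (ha : 0 < a) (hb : 0 < b) (hab : a ≠ b) :
    positiveOrthotripods (ellipseCurve c e a b) = {t ∈ aligned | ratio t ^ 2 < 1 ∧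
        ((a ^ 2 - b ^ 2) * (circleProd t : ℂ).re / (2 * a ^ 2)) ^ 2 * (ratio t - 1) ^ 2
        + ((a ^ 2 - b ^ 2) * (circleProd t : ℂ).im / (2 * b ^ 2)) ^ 2 * (ratio t + 1) ^ 2
          < 1} := by
  ext t
  constructor
  · rintro ⟨z, rfl, hz, hq⟩
    obtain ⟨h₁, h₂⟩ := (isOrthotripod_ellipseCurve_iff c e ha hb hab z).1 hz
    exact ⟨h₂, (exists_pos_isBalancedBy_iff c e ha hb h₁ h₂).1 hq⟩
  · rintro ⟨h₁, h₂⟩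
    obtain ⟨z, rfl⟩ := exists_mk_eq t
    have hinj := (injective_iff_deltoidPoly_neg h₁).2 (deltoidPoly_neg_of_sq_lt_one _ h₂.1)
    exact ⟨z, rfl, (isOrthotripod_ellipseCurve_iff c e ha hb hab z).2 ⟨hinj, h₁⟩,
      (exists_pos_isBalancedBy_iff c e ha hb hinj h₁).2 h₂⟩

theorem isEmbedding_circleProd_ratio :
    Topology.IsEmbedding fun t : aligned => (circleProd t.1, ratio t.1) := by
  refine (Continuous.isClosedEmbedding ?_ ?_).isEmbedding
  · exact (continuous_circleProd.comp continuous_subtype_val).prodMk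
      (continuous_ratio.comp continuous_subtype_val)
  · intro t t' h
    exact Subtype.ext (eq_of_aligned t.2 t'.2 (congrArg Prod.fst h) (congrArg Prod.snd h))

/-- A space of aligned triples described by conditions on product and ratio is homeomorphic to
the corresponding subset of the cylinder. -/
theorem nonempty_homeomorph_setOf_aligned {R : Set (Circle × ℝ)}
    (hR : ∀ p r, (p, r) ∈ R → deltoidPoly p r ≤ 0) :
    Nonempty ({t ∈ aligned | (circleProd t, ratio t) ∈ R} ≃ₜ R) := by
  have hsub : {t ∈ aligned | (circleProd t, ratio t) ∈ R} ⊆ aligned := fun _ h => h.1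
  have hemb := isEmbedding_circleProd_ratio.comp (Topology.IsEmbedding.inclusion hsub)
  refine ⟨hemb.toHomeomorph.trans (Homeomorph.setCongr ?_)⟩
  ext ⟨p, r⟩
  constructor
  · rintro ⟨t, ht⟩
    rw [← ht]
    exact t.2.2
  · intro h
    obtain ⟨t, ht, rfl, rfl⟩ := exists_aligned (hR p r h)
    exact ⟨⟨t, ht, h⟩, rfl⟩

theorem nonempty_homeomorph_positiveOrthotripods (ha : 0 < a) (hb : 0 < b) (hab : a ≠ b) :
    Nonempty (positiveOrthotripods (ellipseCurve c e a b) ≃ₜ Circle × Set.Ioo (0 : ℝ) 1) := by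
  rw [positiveOrthotripods_ellipseCurve c e ha hb hab]
  have hk : a ^ 2 - b ^ 2 ≠ 0 := by
    rw [sq_sub_sq]
    exact mul_ne_zero (by positivity) (sub_ne_zero.2 hab)
  have hre : ∀ p : Circle, (p : ℂ).re ^ 2 ≤ 1 := fun p => by
    nlinarith [p.re_sq_add_im_sq, sq_nonneg (p : ℂ).im]
  have him : ∀ p : Circle, (p : ℂ).im ^ 2 ≤ 1 := fun p => by
    nlinarith [p.re_sq_add_im_sq, sq_nonneg (p : ℂ).re]
  -- Here d is the square of the major semi-axis. At r = -1 (if a > b) or r = 1 (if a < b) the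
  -- common point lies on the major axis, inside the ellipse.
  have hfour : ∀ {d x : ℝ}, 0 < d → (a ^ 2 - b ^ 2) ^ 2 < d ^ 2 → x ^ 2 ≤ 1 →
      4 * ((a ^ 2 - b ^ 2) * x / (2 * d)) ^ 2 < 1 := by
    intro d x hd h hx
    have : 4 * ((a ^ 2 - b ^ 2) * x / (2 * d)) ^ 2 = (a ^ 2 - b ^ 2) ^ 2 * x ^ 2 / d ^ 2 := by
      field_simp; ring
    rw [this, div_lt_one (pow_pos hd 2)]
    exact (mul_le_of_le_one_right (sq_nonneg _) hx).trans_lt h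
  obtain ⟨φ⟩ := nonempty_homeomorph_conic_region (X := Circle)
    (A := fun p => ((a ^ 2 - b ^ 2) * (p : ℂ).re / (2 * a ^ 2)) ^ 2)
    (B := fun p => ((a ^ 2 - b ^ 2) * (p : ℂ).im / (2 * b ^ 2)) ^ 2)
    (by fun_prop) (by fun_prop) (fun p => sq_nonneg _) (fun p => sq_nonneg _) (by
      intro p
      refine (add_nonneg (sq_nonneg _) (sq_nonneg _)).lt_of_ne' fun h => ?_
      obtain ⟨h₁, h₂⟩ := eq_zero_and_eq_zero_of_sq_add_sq h
      have h₁ : (p : ℂ).re = 0 := by simpa [hk, ha.ne'] using h₁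
      have h₂ : (p : ℂ).im = 0 := by simpa [hk, hb.ne'] using h₂
      have := p.re_sq_add_im_sq
      rw [h₁, h₂] at this
      norm_num at this) (by
      have ha2 := pow_pos ha 2
      have hb2 := pow_pos hb 2
      rcases hab.lt_or_gt with h | h
      · have := pow_lt_pow_left₀ h ha.le two_ne_zero
        exact Or.inr fun p => hfour hb2 (sq_lt_sq' (by linarith) (by linarith)) (him p)
      · have := pow_lt_pow_left₀ h hb.le two_ne_zero
        exact Or.inl fun p => hfour ha2 (sq_lt_sq' (by linarith) (by linarith)) (hre p))
  obtain ⟨ψ⟩ := nonempty_homeomorph_setOf_aligned (R := {x : Circle × ℝ | x.2 ^ 2 < 1 ∧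
      ((a ^ 2 - b ^ 2) * (x.1 : ℂ).re / (2 * a ^ 2)) ^ 2 * (x.2 - 1) ^ 2
      + ((a ^ 2 - b ^ 2) * (x.1 : ℂ).im / (2 * b ^ 2)) ^ 2 * (x.2 + 1) ^ 2 < 1})
    fun p r h => (deltoidPoly_neg_of_sq_lt_one p h.1).le
  exact ⟨ψ.trans φ⟩

end SymPower

/-- For an ellipse that is not a circle, the closure of the space of orthotripods in the symmetric
cube of `S¹` is homeomorphic to the closed cylinder `S¹ × [0, 1]`, and the space of orthotripods
that can be balanced by positive charges is homeomorphic to the open cylinder `S¹ × (0, 1)`. -/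
theorem mainTheorem5 (c : Plane) (e : OrthonormalBasis (Fin 2) ℝ Plane) (a b : ℝ)
    (ha : 0 < a) (hb : 0 < b) (hab : a ≠ b) :
    Nonempty (↥(closure (orthotripods (ellipseCurve c e a b))) ≃ₜ
      Circle × ↥(Set.Icc (0 : ℝ) 1)) ∧
    Nonempty (↥(positiveOrthotripods (ellipseCurve c e a b)) ≃ₜ
      Circle × ↥(Set.Ioo (0 : ℝ) 1)) := by
  refine ⟨?_, SymPower.nonempty_homeomorph_positiveOrthotripods c e ha hb hab⟩
  rw [SymPower.closure_orthotripods_ellipseCurve c e ha hb hab]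
  exact ⟨SymPower.alignedHomeomorph.trans
    ((Homeomorph.refl Circle).prodCongr (iccHomeoI (-27) 27 (by norm_num)))⟩
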